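/- Let $\mathbb T=\{z\in\mathbb C:|z|=1\}$ and identify $\mathbb C$ with $\mathbb R^2$. For $s>0$ and a configuration $A=\{x_1,\dots,x_m\}\subset\mathbb T$ of $m\ge 1$ points (coincident points are allowed and counted with multiplicity) put $$M^s(A,\mathbb T)=\inf_{x\in\mathbb T}\sum_{j=1}^m|x-x_j|^{-s},\qquad M^s_m(\mathbb T)=\sup_{A}M^s(A,\mathbb T),$$ where $0^{-s}=+\infty$ and the supremum is over all such configurations of $m$ points. For $\alpha<2$ let $C^\delta_{\mathbb T}(\alpha,m)$ be the largest real constant $C$ such that $$\frac1m\sum_{j=1}^m\inf_{x\in\mathbb T}|x-x_j|^{\alpha-2}\ \ge\ C+\frac1m\inf_{x\in\mathbb T}\sum_{j=1}^m|x-x_j|^{\alpha-2}\qquad\text{for all }x_1,\dots,x_m\in\mathbb T.$$ For $1<\alpha<2$ let $W_\alpha(\mathbb T)$ be the minimum of the energy $\iint|x-t|^{\alpha-2}\,d\mu(t)\,d\mu(x)$ over unit Borel measures $\mu$ on $\mathbb T$, let $\mu_\alpha$ be the equilibrium measure, which attains it, let $d_{\mathbb T}(x)=\sup_{t\in\mathbb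 T}|x-t|$, and put $C_{\mathbb T}(\alpha)=\int d_{\mathbb T}^{\alpha-2}\,d\mu_\alpha-W_\alpha(\mathbb T)$. **Proposition 3.2.** For every real $\alpha<2$ and every integer $m\ge1$, the constant $C^\delta_{\mathbb T}(\alpha,m)$ exists, $M^{2-\alpha}_m(\mathbb T)$ is finite, and $$C^\delta_{\mathbb T}(\alpha,m)=2^{\alpha-2}-\frac{M^{2-\alpha}(A_m^*,\mathbb T)}{m}=2^{\alpha-2}-\frac{M^{2-\alpha}_m(\mathbb T)}{m},$$ where $A_m^*=\{e^{2\pi i k/m}:k=1,\dots,m\}$. Moreover, for fixed $\alpha$, as $m\to\infty$, $$C^\delta_{\mathbb T}(\alpha,m)\sim\begin{cases}-\dfrac{2\,\zeta(2-\alpha)}{(2\pi)^{2-\alpha}}\,(2^{2-\alpha}-1)\,m^{1-\alpha},&\alpha<1,\\[2mm]-\dfrac1\pi\log m,&\alpha=1,\\[2mm]2^{\alpha-2}-\dfrac{2^{\alpha-2}}{\sqrt\pi}\,\dfrac{\Gamma\left(\frac{\alpha-1}2\right)}{\Gamma\left(\frac\alpha2\right)}=C_{\mathbb T}(\alpha),&1<\alpha<2,\end{cases}$$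 where $\zeta$ is the Riemann zeta function and $a_m\sim b_m$ means $\lim_{m\to\infty}a_m/b_m=1$. -/

import Mathlib

open MeasureTheory Filter Topology
open scoped ENNReal

noncomputable section

/-- The Riesz `s`-kernel `|x - t|^(-s)` on the plane, with values in `[0, ∞]`.
For `s > 0` its value at `x = t` is `∞`. -/
def rieszKernel (s : ℝ) (x t : ℂ) : ℝ≥0∞ := edist x t ^ (-s)

/-- The polarization `M^s(A, E) = inf_{x ∈ E} ∑_j |x - a_j|^(-s)` of a configuration
`A = {a_1, …, a_m}`. -/
def rieszPolarization (s : ℝ) {m : ℕ} (a : Fin m → ℂ) (E : Set ℂ) : ℝ≥0∞ :=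
  ⨅ x ∈ E, ∑ j, rieszKernel s x (a j)

/-- The maximal polarization `M^s_m(E)`, the supremum of `M^s(A, E)` over all `m`-point
configurations in `E`. Coincident points are allowed. -/
def rieszMaxPolarization (s : ℝ) (m : ℕ) (E : Set ℂ) : ℝ≥0∞ :=
  ⨆ (a : Fin m → ℂ) (_ : ∀ j, a j ∈ E), rieszPolarization s a E

/-- The real numbers `C` such that, for all points `a_1, …, a_m` of `E`,
`(1/m) ∑_j inf_{x ∈ E} |x - a_j|^(α-2) ≥ C + (1/m) inf_{x ∈ E} ∑_j |x - a_j|^(α-2)`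
(an inequality between extended real numbers). -/
def pointMassConstants (α : ℝ) (m : ℕ) (E : Set ℂ) : Set ℝ :=
  {C : ℝ | ∀ a : Fin m → ℂ, (∀ j, a j ∈ E) →
    (C : EReal) + (((⨅ x ∈ E, ∑ j, rieszKernel (2 - α) x (a j)) / (m : ℝ≥0∞) : ℝ≥0∞) : EReal)
      ≤ (((∑ j, ⨅ x ∈ E, rieszKernel (2 - α) x (a j)) / (m : ℝ≥0∞) : ℝ≥0∞) : EReal)}

/-- `C^δ_E(α, m)`, the best constant in the reverse triangle inequality for point masses. -/
def pointMassConstant (α : ℝ) (m : ℕ) (E : Set ℂ) : ℝ := sSup (pointMassConstants α m E)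

/-- The Riesz potential `U^μ_α(x) = ∫ |x - t|^(α-2) dμ(t)` in the plane. -/
def rieszPotential (α : ℝ) (μ : Measure ℂ) (x : ℂ) : ℝ≥0∞ := ∫⁻ t, rieszKernel (2 - α) x t ∂μ

/-- The `α`-energy `∫ U^μ_α dμ`. -/
def rieszEnergy (α : ℝ) (μ : Measure ℂ) : ℝ≥0∞ := ∫⁻ x, rieszPotential α μ x ∂μ

/-- The minimal `α`-energy `W_α(E)` of unit Borel measures carried by `E`. -/
def wienerConstant (α : ℝ) (E : Set ℂ) : ℝ≥0∞ :=
  ⨅ (μ : Measure ℂ) (_ : IsProbabilityMeasure μ) (_ : μ Eᶜ = 0), rieszEnergy α μ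

/-- `μ` is an `α`-equilibrium measure of `E`: a unit Borel measure carried by `E` whose
`α`-energy is minimal and finite. -/
structure IsRieszEquilibriumMeasure (α : ℝ) (E : Set ℂ) (μ : Measure ℂ) : Prop where
  isProbabilityMeasure : IsProbabilityMeasure μ
  carried : μ Eᶜ = 0
  energy_eq : rieszEnergy α μ = wienerConstant α E
  energy_ne_top : rieszEnergy α μ ≠ ∞

open Classical in
/-- The `α`-equilibrium measure of `E` (and `0` if there is none). -/
def rieszEquilibriumMeasure (α : ℝ) (E : Set ℂ) : Measure ℂ :=
  if h : ∃ μ, IsRieszEquilibriumMeasure α E μ then h.choose else 0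

/-- The farthest distance function `d_E(x) = sup_{t ∈ E} |x - t|` of a bounded set. -/
def farthestDist (E : Set ℂ) (x : ℂ) : ℝ := ⨆ t : E, ‖x - t‖

/-- `C_E(α) = ∫ d_E^(α-2) dμ_α - W_α(E)`, with `μ_α` the `α`-equilibrium measure of `E`. -/
def reverseTriangleConstant (α : ℝ) (E : Set ℂ) : ℝ :=
  ∫ x, farthestDist E x ^ (α - 2) ∂(rieszEquilibriumMeasure α E) - (wienerConstant α E).toReal

/-- The unit circle in the plane. -/
def planeCircle : Set ℂ := Metric.sphere (0 : ℂ) 1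

/-- The `m`-th roots of unity `exp(2πik/m)`, `k = 1, …, m`. -/
def unityRoots (m : ℕ) : Fin m → ℂ :=
  fun k => Complex.exp (2 * (Real.pi : ℂ) * Complex.I * (((k : ℕ) + 1 : ℕ) : ℂ) / (m : ℂ))

end

/-! With s = 2 − α, the kernel on the circle is (2 sin(θ/2))^(-s) in the angle θ, and it is convex
on (0, 2π); almost everything follows from this. A single kernel is smallest at the antipode of its
pole, with value 2^(-s) whatever the pole, so the best constant is 2^(-s) minus the maximal
polarization divided by m.

That polarization is `midpointSum`, the potential of m equally spaced points halfway between two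
neighbours. For an arbitrary configuration there is a point of the circle from which the sorted
angles are majorized by the midpoints π(2i+1)/m, and Karamata's inequality bounds the potential
there (`exists_sum_rieszKernel_le`). For the roots of unity, convexity makes the halfway points
minimal (`midpointSum_le`).

The asymptotics are those of the midpoint rule for the kernel. For s > 1 the nodes next to the
singularity dominate and, scaled by m^s, give the series of odd powers; for s = 1 harmonic sums give
(log m)/π; for s < 1 the rule converges to the mean `circleMean`, a Beta integral.

For 1 < α < 2 that mean is also the Wiener constant. Arc length has constant potential on the
circle, which gives one inequality. Conversely, the energy of any measure dominates the average
discrete energy of independent samples from it, and by convexity equally spaced points minimize the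
discrete energy. -/

/-! ### Convexity and monotonicity of the kernel in the angle. -/

/-- The Riesz kernel on the unit circle, as a function of the angle between two points. -/
noncomputable def circleKernel (s θ : ℝ) : ℝ := (2 * Real.sin (θ / 2)) ^ (-s)

theorem two_mul_sin_half_pos {θ : ℝ} (h0 : 0 < θ) (h1 : θ < 2 * Real.pi) :
    0 < 2 * Real.sin (θ / 2) :=
  mul_pos two_pos (Real.sin_pos_of_pos_of_lt_pi (by linarith) (by linarith))

theorem circleKernel_pos (s : ℝ) {θ : ℝ} (h0 : 0 < θ) (h1 : θ < 2 * Real.pi) :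
    0 < circleKernel s θ :=
  Real.rpow_pos_of_pos (two_mul_sin_half_pos h0 h1) _

theorem circleKernel_symm (s θ : ℝ) : circleKernel s (2 * Real.pi - θ) = circleKernel s θ := by
  unfold circleKernel
  rw [show (2 * Real.pi - θ) / 2 = Real.pi - θ / 2 by ring, Real.sin_pi_sub]

/-- The function is exp(−s log t), the increasing convex exponential of a convex function. -/
theorem convexOn_rpow_neg {s : ℝ} (hs : 0 < s) :
    ConvexOn ℝ (Set.Ioi 0) (fun t : ℝ => t ^ (-s)) := by
  refine ⟨convex_Ioi _, fun x hx y hy a b ha hb hab => ?_⟩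
  have hlog := strictConcaveOn_log_Ioi.concaveOn.2 hx hy ha hb hab
  have hexp := convexOn_exp.2 (Set.mem_univ (Real.log x * -s)) (Set.mem_univ (Real.log y * -s))
    ha hb hab
  have hxy : 0 < a • x + b • y := convex_Ioi (0 : ℝ) hx hy ha hb hab
  simp only [Real.rpow_def_of_pos hx, Real.rpow_def_of_pos hy, Real.rpow_def_of_pos hxy]
  refine (Real.exp_le_exp.2 ?_).trans hexp
  simp only [smul_eq_mul] at hlog ⊢
  nlinarith

/-- Sine is concave on [0, π], and t^(-s) is decreasing and convex. -/
theorem convexOn_circleKernel {s : ℝ} (hs : 0 < s) :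
    ConvexOn ℝ (Set.Ioo 0 (2 * Real.pi)) (circleKernel s) := by
  refine ⟨convex_Ioo _ _, ?_⟩
  intro x hx y hy a b ha hb hab
  have px := two_mul_sin_half_pos hx.1 hx.2
  have py := two_mul_sin_half_pos hy.1 hy.2
  have hsin : a * (2 * Real.sin (x / 2)) + b * (2 * Real.sin (y / 2)) ≤
      2 * Real.sin ((a * x + b * y) / 2) := by
    have h := strictConcaveOn_sin_Icc.concaveOn.2
      (x := x / 2) ⟨by linarith [hx.1], by linarith [hx.2]⟩
      (y := y / 2) ⟨by linarith [hy.1], by linarith [hy.2]⟩ ha hb hab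
    simp only [smul_eq_mul] at h
    rw [show (a * x + b * y) / 2 = a * (x / 2) + b * (y / 2) by ring]
    linarith
  have hpos : 0 < a * (2 * Real.sin (x / 2)) + b * (2 * Real.sin (y / 2)) := by
    rcases ha.eq_or_lt with h | h
    · subst h; have : b = 1 := by linarith
      subst this; simpa using py
    · have := mul_pos h px
      have := mul_nonneg hb py.le
      linarith
  have hc := convexOn_rpow_neg hs
  simp only [smul_eq_mul, circleKernel]
  exact (Real.rpow_le_rpow_of_nonpos hpos hsin (by linarith)).trans
    (hc.2 px py ha hb hab)

theorem differentiableAt_circleKernel (s : ℝ) {θ : ℝ} (h0 : 0 < θ) (h1 : θ < 2 * Real.pi) :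
    DifferentiableAt ℝ (circleKernel s) θ := by
  unfold circleKernel
  have := (two_mul_sin_half_pos h0 h1).ne'
  fun_prop (disch := assumption)

theorem antitoneOn_circleKernel {s : ℝ} (hs : 0 < s) :
    AntitoneOn (circleKernel s) (Set.Ioc 0 Real.pi) := by
  intro x hx y hy hxy
  have := Real.pi_pos
  refine Real.rpow_le_rpow_of_nonpos (two_mul_sin_half_pos hx.1 (by linarith [hx.2])) ?_ (by linarith)
  have := Real.sin_le_sin_of_le_of_le_pi_div_two (x := x / 2) (y := y / 2) (by linarith [hx.1])
    (by linarith [hy.2]) (by linarith)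
  linarith

/-! ### Tangent lines and Karamata's inequality. -/

/-- A convex function lies above its tangent lines. -/
theorem ConvexOn.tangent_le {S : Set ℝ} {f : ℝ → ℝ} (hf : ConvexOn ℝ S f) {x y : ℝ} (hx : x ∈ S)
    (hy : y ∈ S) (hd : DifferentiableAt ℝ f x) : f x + deriv f x * (y - x) ≤ f y := by
  rcases lt_trichotomy x y with h | h | h
  · have := hf.deriv_le_slope hx hy h hd
    rw [slope_def_field, le_div_iff₀ (by linarith)] at this
    linarith
  · subst h; simp
  · have := hf.slope_le_deriv hy hx h hd
    rw [slope_def_field, div_le_iff₀ (by linarith)] at this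
    linarith

/-- A monotone sequence of weights, summed against a sequence with nonpositive partial sums. -/
theorem mul_sum_le_sum_mul_of_monotone {n : ℕ} {p d : ℕ → ℝ}
    (hp : ∀ i, i + 1 < n + 1 → p i ≤ p (i + 1))
    (hd : ∀ k, k ≤ n → ∑ i ∈ Finset.range k, d i ≤ 0) :
    p n * ∑ i ∈ Finset.range (n + 1), d i ≤ ∑ i ∈ Finset.range (n + 1), p i * d i := by
  induction n with
  | zero => simp
  | succ n ih =>
    have h1 := ih (fun i hi => hp i (by omega)) (fun k hk => hd k (by omega))
    have h2 := hd (n + 1) le_rfl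
    have h3 := hp n (by omega)
    rw [Finset.sum_range_succ, Finset.sum_range_succ (fun i => p i * d i)]
    nlinarith [mul_nonneg_of_nonpos_of_nonpos h2 (sub_nonpos.2 h3)]

/-- Karamata's inequality. -/
theorem ConvexOn.sum_le_sum_of_majorized {S : Set ℝ} {f : ℝ → ℝ}
    (hf : ConvexOn ℝ S f) (hfd : ∀ x ∈ S, DifferentiableAt ℝ f x) {n : ℕ} {x y : ℕ → ℝ}
    (hx : ∀ i < n, x i ∈ S) (hy : ∀ i < n, y i ∈ S) (hmono : Monotone x)
    (hle : ∀ k ≤ n, ∑ i ∈ Finset.range k, y i ≤ ∑ i ∈ Finset.range k, x i)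
    (heq : ∑ i ∈ Finset.range n, y i = ∑ i ∈ Finset.range n, x i) :
    ∑ i ∈ Finset.range n, f (x i) ≤ ∑ i ∈ Finset.range n, f (y i) := by
  rcases n with _ | n
  · simp
  have h1 : ∑ i ∈ Finset.range (n + 1), (f (x i) + deriv f (x i) * (y i - x i)) ≤
      ∑ i ∈ Finset.range (n + 1), f (y i) := Finset.sum_le_sum fun i hi =>
    hf.tangent_le (hx i (Finset.mem_range.1 hi)) (hy i (Finset.mem_range.1 hi))
      (hfd _ (hx i (Finset.mem_range.1 hi)))
  -- The tangent inequality leaves the sum of f′(x i)(y i − x i). Abel summation makes it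
  -- nonnegative: the slopes increase along x, the partial sums of y − x are nonpositive and the
  -- total vanishes.
  have hmd : MonotoneOn (deriv f) S := hf.monotoneOn_deriv hfd
  have h2 := mul_sum_le_sum_mul_of_monotone (n := n) (p := fun i => deriv f (x i))
    (d := fun i => y i - x i)
    (fun i hi => hmd (hx i (by omega)) (hx _ hi) (hmono (Nat.le_succ i)))
    (fun k hk => by rw [Finset.sum_sub_distrib]; linarith [hle k (by omega)])
  rw [Finset.sum_sub_distrib, heq, sub_self, mul_zero] at h2
  rw [Finset.sum_add_distrib] at h1
  linarith

/-! ### Points of the circle and their angles. -/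

theorem edist_exp_mul_I (φ θ : ℝ) :
    edist (Complex.exp (φ * Complex.I)) (Complex.exp (θ * Complex.I)) =
      ENNReal.ofReal |2 * Real.sin ((θ - φ) / 2)| := by
  rw [edist_dist, dist_comm, dist_eq_norm]
  congr 1
  have h : Complex.exp (θ * Complex.I) - Complex.exp (φ * Complex.I) =
      Complex.exp (φ * Complex.I) * (Complex.exp (Complex.I * ((θ - φ : ℝ) : ℂ)) - 1) := by
    rw [mul_sub, ← Complex.exp_add, mul_one]
    congr 2
    push_cast
    ring
  rw [h, norm_mul, Complex.norm_exp_ofReal_mul_I, one_mul, Complex.norm_exp_I_mul_ofReal_sub_one,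
    Real.norm_eq_abs]

theorem rieszKernel_exp (s : ℝ) {φ θ : ℝ} (h0 : φ < θ) (h1 : θ < φ + 2 * Real.pi) :
    rieszKernel s (Complex.exp (φ * Complex.I)) (Complex.exp (θ * Complex.I)) =
      ENNReal.ofReal (circleKernel s (θ - φ)) := by
  have h := two_mul_sin_half_pos (θ := θ - φ) (by linarith) (by linarith)
  rw [rieszKernel, edist_exp_mul_I, abs_of_pos h, ENNReal.ofReal_rpow_of_pos h, circleKernel]

theorem rieszKernel_self {s : ℝ} (hs : 0 < s) (x : ℂ) : rieszKernel s x x = ∞ := by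
  rw [rieszKernel, edist_self, ENNReal.zero_rpow_of_neg (by linarith)]

theorem measurable_rieszKernel (s : ℝ) : Measurable fun p : ℂ × ℂ => rieszKernel s p.1 p.2 := by
  unfold rieszKernel
  fun_prop

theorem exp_mem_planeCircle (θ : ℝ) : Complex.exp (θ * Complex.I) ∈ planeCircle := by
  simp [planeCircle, Complex.norm_exp_ofReal_mul_I]

theorem exp_arg_mul_I {z : ℂ} (hz : z ∈ planeCircle) : Complex.exp (z.arg * Complex.I) = z := by
  have h : ‖z‖ = 1 := by simpa [planeCircle] using hz
  simpa [h] using Complex.norm_mul_exp_arg_mul_I z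

theorem exp_add_two_pi_mul_I (θ : ℝ) (n : ℕ) :
    Complex.exp ((θ + 2 * Real.pi * n : ℝ) * Complex.I) = Complex.exp (θ * Complex.I) := by
  have := Complex.exp_periodic.nat_mul n (θ * Complex.I)
  rw [← this]
  congr 1
  push_cast
  ring

theorem sum_range_add_of_periodic {M : Type*} [AddCommMonoid M] {m : ℕ} {F : ℕ → M}
    (hF : ∀ k, F (k + m) = F k) (j : ℕ) :
    ∑ i ∈ Finset.range m, F (j + i) = ∑ i ∈ Finset.range m, F i := by
  rcases m with _ | n
  · simp
  induction j with
  | zero => simp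
  | succ j ih =>
    rw [← ih, Finset.sum_range_succ, Finset.sum_range_succ' (fun i => F (j + i))]
    congr 1
    · exact Finset.sum_congr rfl fun i _ => by rw [add_right_comm, add_assoc]
    · rw [add_zero, ← hF j]; congr 1; ring

/-- Finitely many points of the circle have arguments that, after sorting, extend to a monotone
sequence which increases by `2π` over each period. -/
theorem exists_monotone_lift {m : ℕ} (hm : 0 < m) {a : Fin m → ℂ} (ha : ∀ j, a j ∈ planeCircle) :
    ∃ x : ℕ → ℝ, Monotone x ∧ (∀ k, x (k + m) = x k + 2 * Real.pi) ∧
      ∃ σ : Equiv.Perm (Fin m), ∀ i : Fin m, Complex.exp (x i * Complex.I) = a (σ i) := by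
  set θ : Fin m → ℝ := fun j => (a j).arg with hθ
  set σ := Tuple.sort θ
  have hσ : Monotone (θ ∘ σ) := Tuple.monotone_sort θ
  -- The remainder of k mod m selects a sorted argument and the quotient counts turns. Arguments lie
  -- in (−π, π], so an extra turn outweighs any drop between arguments.
  refine ⟨fun k => θ (σ ⟨k % m, Nat.mod_lt _ hm⟩) + 2 * Real.pi * (k / m : ℕ), ?_, ?_, σ, ?_⟩
  · intro k l hkl
    have hπ := Real.pi_pos
    rcases (Nat.div_le_div_right (c := m) hkl).eq_or_lt with h | h
    · have : k % m ≤ l % m := by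
        have h1 := Nat.div_add_mod k m
        have h2 := Nat.div_add_mod l m
        rw [h] at h1
        omega
      have h3 := @hσ ⟨k % m, Nat.mod_lt _ hm⟩ ⟨l % m, Nat.mod_lt _ hm⟩ this
      simp only [Function.comp] at h3
      simp only [h]
      linarith
    · have h1 := Complex.arg_le_pi (a (σ ⟨k % m, Nat.mod_lt _ hm⟩))
      have h2 := Complex.neg_pi_lt_arg (a (σ ⟨l % m, Nat.mod_lt _ hm⟩))
      have h3 : ((k / m : ℕ) : ℝ) + 1 ≤ ((l / m : ℕ) : ℝ) := by exact_mod_cast h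
      simp only [hθ]
      nlinarith
  · intro k
    simp only [Nat.add_mod_right, Nat.add_div_right k hm]
    push_cast
    ring
  · intro i
    simp only [Nat.mod_eq_of_lt i.2, Nat.div_eq_of_lt i.2]
    simpa [hθ] using exp_arg_mul_I (ha (σ i))

/-! ### Upper bound for the polarization of an arbitrary configuration. -/

/-- The potential of `m` equally spaced points of the circle, halfway between two of them. -/
noncomputable def midpointSum (s : ℝ) (m : ℕ) : ℝ :=
  ∑ i ∈ Finset.range m, circleKernel s (Real.pi * (2 * i + 1) / m)

theorem midpoint_mem {m i : ℕ} (hi : i < m) :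
    Real.pi * (2 * i + 1) / m ∈ Set.Ioo 0 (2 * Real.pi) := by
  have hπ := Real.pi_pos
  have hm : (0 : ℝ) < m := by exact_mod_cast (by omega : 0 < m)
  have hi' : (i : ℝ) + 1 ≤ m := by exact_mod_cast hi
  refine ⟨by positivity, ?_⟩
  rw [div_lt_iff₀ hm]
  nlinarith

/-- The cycle lemma: since the total over a period is zero, the partial sums are periodic, so they
attain a minimum. Starting at the minimizing index, no later partial sum is negative. -/
theorem exists_sum_shift_nonneg {m : ℕ} (hm : 0 < m) {D : ℕ → ℝ} (hD : ∀ k, D (k + m) = D k)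
    (h0 : ∑ i ∈ Finset.range m, D i = 0) :
    ∃ j, ∀ k, 0 ≤ ∑ i ∈ Finset.range k, D (j + i) := by
  obtain ⟨j, -, hj⟩ := (Finset.range m).exists_min_image
    (fun k => ∑ i ∈ Finset.range k, D i) ⟨0, by simpa using hm⟩
  refine ⟨j, fun k => ?_⟩
  have hper : ∀ k, ∑ i ∈ Finset.range (k + m), D i = ∑ i ∈ Finset.range k, D i := by
    intro k
    rw [Finset.sum_range_add, sum_range_add_of_periodic hD, h0, add_zero]
  have hmod : ∀ k, ∑ i ∈ Finset.range k, D i = ∑ i ∈ Finset.range (k % m), D i := fun k =>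
    (Function.Periodic.map_mod_nat (f := fun k => ∑ i ∈ Finset.range k, D i) hper k).symm
  have h1 := Finset.sum_range_add D j k
  have h2 := hj _ (Finset.mem_range.2 (Nat.mod_lt (j + k) hm))
  rw [← hmod] at h2
  linarith

theorem sum_two_pi_mul_div {m : ℕ} (hm : 0 < m) (c : ℝ) :
    ∃ b, ∑ i ∈ Finset.range m, (b + 2 * Real.pi * i / m) = c := by
  refine ⟨(c - ∑ i ∈ Finset.range m, (2 * Real.pi * i / m)) / m, ?_⟩
  have : (m : ℝ) ≠ 0 := by positivity
  rw [Finset.sum_add_distrib, Finset.sum_const, Finset.card_range, nsmul_eq_mul]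
  field_simp
  ring

/-- The sorted angles are compared with an equally spaced sequence of the same sum. The deviation D
is periodic with zero total, so the cycle lemma supplies a starting index from which the angles have
larger partial sums than the midpoints, as Karamata's inequality requires. -/
theorem exists_sum_rieszKernel_le {s : ℝ} (hs : 0 < s) {m : ℕ} (hm : 0 < m) {x : ℕ → ℝ}
    (hx : Monotone x) (hper : ∀ k, x (k + m) = x k + 2 * Real.pi) :
    ∃ φ : ℝ, ∑ i ∈ Finset.range m, rieszKernel s (Complex.exp (φ * Complex.I))
      (Complex.exp (x i * Complex.I)) ≤ ENNReal.ofReal (midpointSum s m) := by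
  have hm' : (0 : ℝ) < m := by exact_mod_cast hm
  have hπ := Real.pi_pos
  obtain ⟨b, hb⟩ := sum_two_pi_mul_div hm (∑ i ∈ Finset.range m, x i)
  set D : ℕ → ℝ := fun k => x k - (b + 2 * Real.pi * k / m) with hDdef
  have hD : ∀ k, D (k + m) = D k := by
    intro k
    simp only [hDdef, hper]
    push_cast
    field_simp
    ring
  have hD0 : ∑ i ∈ Finset.range m, D i = 0 := by
    rw [Finset.sum_sub_distrib, hb, sub_self]
  obtain ⟨j, hj⟩ := exists_sum_shift_nonneg hm hD hD0
  have hjm : ∑ i ∈ Finset.range m, D (j + i) = 0 := by rw [sum_range_add_of_periodic hD, hD0]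
  -- Half a step before the j-th equally spaced point, so that the equally spaced angles seen from φ
  -- are exactly the midpoints.
  set φ : ℝ := b + 2 * Real.pi * j / m - Real.pi / m with hφ
  have hxD : ∀ i, x (j + i) - φ = D (j + i) + Real.pi * (2 * i + 1) / m := by
    intro i
    simp only [hDdef, hφ]
    push_cast
    field_simp
    ring
  -- The first deviation is nonnegative and the last nonpositive; with monotonicity of x this keeps
  -- every angle seen from φ inside (0, 2π), where the kernel is convex.
  have hfirst : 0 ≤ D j := by simpa using hj 1
  have hlast : D (j + (m - 1)) ≤ 0 := by
    have h1 := Finset.sum_range_succ (fun i => D (j + i)) (m - 1)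
    rw [Nat.sub_add_cancel hm, hjm] at h1
    linarith [hj (m - 1)]
  have hmem : ∀ i < m, x (j + i) - φ ∈ Set.Ioo 0 (2 * Real.pi) := by
    intro i hi
    constructor
    · have h1 := hxD 0
      simp only [add_zero, Nat.cast_zero, mul_zero, zero_add, mul_one] at h1
      have h2 : 0 < Real.pi / m := by positivity
      linarith [hx (Nat.le_add_right j i)]
    · have h1 := hxD (m - 1)
      have h2 := (midpoint_mem (Nat.sub_lt hm one_pos)).2
      linarith [hx (by omega : j + i ≤ j + (m - 1))]
  refine ⟨φ, ?_⟩
  rw [← sum_range_add_of_periodic (F := fun i => rieszKernel s (Complex.exp (φ * Complex.I))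
      (Complex.exp (x i * Complex.I))) (fun k => by
        have := exp_add_two_pi_mul_I (x k) 1
        simp only [Nat.cast_one, mul_one] at this
        simp only [hper, this]) j]
  rw [Finset.sum_congr rfl fun i hi => rieszKernel_exp s
    (by linarith [(hmem i (Finset.mem_range.1 hi)).1])
    (by linarith [(hmem i (Finset.mem_range.1 hi)).2])]
  rw [← ENNReal.ofReal_sum_of_nonneg fun i hi => (circleKernel_pos s
    (hmem i (Finset.mem_range.1 hi)).1 (hmem i (Finset.mem_range.1 hi)).2).le]
  refine ENNReal.ofReal_le_ofReal ?_
  have hsum : ∀ k, ∑ i ∈ Finset.range k, (x (j + i) - φ) = ∑ i ∈ Finset.range k, D (j + i) +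
      ∑ i ∈ Finset.range k, Real.pi * (2 * i + 1) / m := by
    intro k
    rw [← Finset.sum_add_distrib]
    exact Finset.sum_congr rfl fun i _ => hxD i
  refine (convexOn_circleKernel hs).sum_le_sum_of_majorized
    (fun y hy => differentiableAt_circleKernel s hy.1 hy.2) hmem (fun i hi => midpoint_mem hi)
    (fun i l hil => by linarith [hx (Nat.add_le_add_left hil j)]) (fun k _ => ?_) ?_
  · linarith [hsum k, hj k]
  · rw [hsum m, hjm, zero_add]

theorem rieszPolarization_le {s : ℝ} (hs : 0 < s) {m : ℕ} (hm : 0 < m) {a : Fin m → ℂ}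
    (ha : ∀ j, a j ∈ planeCircle) :
    rieszPolarization s a planeCircle ≤ ENNReal.ofReal (midpointSum s m) := by
  obtain ⟨x, hx, hper, σ, hσ⟩ := exists_monotone_lift hm ha
  obtain ⟨φ, hφ⟩ := exists_sum_rieszKernel_le hs hm hx hper
  refine (iInf₂_le _ (exp_mem_planeCircle φ)).trans (le_trans (le_of_eq ?_) hφ)
  rw [← Fin.sum_univ_eq_sum_range (fun i => rieszKernel s (Complex.exp (φ * Complex.I))
    (Complex.exp (x i * Complex.I))), ← Equiv.sum_comp σ]
  simp only [hσ]

/-! ### Polarization of the roots of unity. -/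

theorem unityRoots_mem (m : ℕ) (k : Fin m) : unityRoots m k ∈ planeCircle := by
  have : unityRoots m k = Complex.exp ((2 * Real.pi * ((k : ℕ) + 1 : ℕ) / m : ℝ) * Complex.I) := by
    unfold unityRoots
    congr 1
    push_cast
    ring
  rw [this]
  exact exp_mem_planeCircle _

/-- The free starting index j allows the roots to be listed in order from the one just after z. -/
theorem sum_unityRoots (s : ℝ) {m : ℕ} (z : ℂ) (j : ℕ) :
    ∑ k, rieszKernel s z (unityRoots m k) = ∑ i ∈ Finset.range m, rieszKernel s z
      (Complex.exp ((2 * Real.pi * (j + i : ℕ) / m : ℝ) * Complex.I)) := by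
  rcases Nat.eq_zero_or_pos m with rfl | hm
  · simp
  have hm' : (m : ℝ) ≠ 0 := by positivity
  have hF : ∀ k : ℕ, rieszKernel s z
      (Complex.exp ((2 * Real.pi * (k + m : ℕ) / m : ℝ) * Complex.I)) = rieszKernel s z
      (Complex.exp ((2 * Real.pi * (k : ℕ) / m : ℝ) * Complex.I)) := by
    intro k
    rw [← exp_add_two_pi_mul_I (2 * Real.pi * (k : ℕ) / m) 1]
    congr 4
    push_cast
    field_simp
  have hrot := sum_range_add_of_periodic (F := fun k : ℕ => rieszKernel s z
      (Complex.exp ((2 * Real.pi * (k : ℕ) / m : ℝ) * Complex.I))) hF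
  rw [hrot, ← hrot 1,
    ← Fin.sum_univ_eq_sum_range (fun i => rieszKernel s z
      (Complex.exp ((2 * Real.pi * (1 + i : ℕ) / m : ℝ) * Complex.I)))]
  refine Finset.sum_congr rfl fun k _ => ?_
  unfold unityRoots
  congr 2
  push_cast
  ring

/-- The potential of equally spaced points is smallest halfway between them. -/
theorem midpointSum_le {s : ℝ} (hs : 0 < s) {m : ℕ} {t : ℝ} (ht : 0 < t)
    (htm : t < 2 * Real.pi / m) :
    midpointSum s m ≤ ∑ i ∈ Finset.range m, circleKernel s (t + 2 * Real.pi * i / m) := by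
  rcases Nat.eq_zero_or_pos m with rfl | hm
  · simp [midpointSum]
  have hm' : (0 : ℝ) < m := by exact_mod_cast hm
  have hπ := Real.pi_pos
  have hlt : ∀ u < 2 * Real.pi / m, ∀ i < m, u + 2 * Real.pi * i / m < 2 * Real.pi := by
    intro u hu i hi
    have hi' : (i : ℝ) + 1 ≤ m := by exact_mod_cast hi
    rw [lt_div_iff₀ hm'] at hu
    rw [← sub_pos]
    have : 2 * Real.pi - (u + 2 * Real.pi * i / m) =
      (2 * Real.pi * (m - i) - u * m) / m := by field_simp; ring
    rw [this]
    apply div_pos _ hm'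
    nlinarith
  -- Reflecting the circle exchanges the offsets t and 2π/m − t. Averaging the two sums and using
  -- convexity term by term yields the midpoints.
  have hrefl : ∑ i ∈ Finset.range m, circleKernel s (t + 2 * Real.pi * i / m) =
      ∑ i ∈ Finset.range m, circleKernel s (2 * Real.pi / m - t + 2 * Real.pi * i / m) := by
    rw [← Finset.sum_range_reflect]
    refine Finset.sum_congr rfl fun i hi => ?_
    have hi : i < m := Finset.mem_range.1 hi
    rw [← circleKernel_symm]
    congr 1
    rw [show m - 1 - i = m - (1 + i) by omega, Nat.cast_sub (by omega)]
    push_cast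
    field_simp
    ring
  have key : 2 * midpointSum s m ≤
      ∑ i ∈ Finset.range m, circleKernel s (t + 2 * Real.pi * i / m) +
      ∑ i ∈ Finset.range m, circleKernel s (2 * Real.pi / m - t + 2 * Real.pi * i / m) := by
    rw [midpointSum, Finset.mul_sum, ← Finset.sum_add_distrib]
    refine Finset.sum_le_sum fun i hi => ?_
    have hi : i < m := Finset.mem_range.1 hi
    have h0 : 0 ≤ 2 * Real.pi * i / m := by positivity
    have h := (convexOn_circleKernel hs).right (x := t + 2 * Real.pi * i / m)
      ⟨by linarith, hlt t htm i hi⟩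
      (y := 2 * Real.pi / m - t + 2 * Real.pi * i / m)
      ⟨by linarith, hlt _ (by linarith) i hi⟩ 
      (show (0 : ℝ) ≤ 1 / 2 by norm_num) (show (0 : ℝ) ≤ 1 / 2 by norm_num) (by norm_num)
    simp only [smul_eq_mul] at h
    rw [show 1 / 2 * (t + 2 * Real.pi * i / m) +
      1 / 2 * (2 * Real.pi / m - t + 2 * Real.pi * i / m) = Real.pi * (2 * i + 1) / m by
        field_simp; ring] at h
    linarith
  linarith

theorem midpointSum_le_sum_unityRoots {s : ℝ} (hs : 0 < s) {m : ℕ} (hm : 0 < m) {z : ℂ}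
    (hz : z ∈ planeCircle) :
    ENNReal.ofReal (midpointSum s m) ≤ ∑ k, rieszKernel s z (unityRoots m k) := by
  have hm' : (0 : ℝ) < m := by exact_mod_cast hm
  have hπ := Real.pi_pos
  -- The extra turn makes the angle positive, so a natural-number floor can locate it between
  -- neighbouring roots.
  set φ : ℝ := z.arg + 2 * Real.pi * (1 : ℕ) with hφ
  have hzφ : z = Complex.exp (φ * Complex.I) := by
    rw [hφ, exp_add_two_pi_mul_I, exp_arg_mul_I hz]
  have hφ0 : 0 < φ := by
    have := Complex.neg_pi_lt_arg z
    rw [hφ]; push_cast; linarith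
  set j := ⌊φ * m / (2 * Real.pi)⌋₊ with hj
  have hj1 : 2 * Real.pi * j / m ≤ φ := by
    have := Nat.floor_le (a := φ * m / (2 * Real.pi)) (by positivity)
    rw [← hj, le_div_iff₀ (by positivity)] at this
    rw [div_le_iff₀ hm']; linarith
  have hj2 : φ < 2 * Real.pi * (j + 1) / m := by
    have := Nat.lt_floor_add_one (φ * m / (2 * Real.pi))
    rw [← hj, div_lt_iff₀ (by positivity)] at this
    rw [lt_div_iff₀ hm']; linarith
  rcases hj1.eq_or_lt with h | h
  -- Here z is itself a root, and its potential is infinite.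
  · rw [sum_unityRoots s z j]
    refine le_trans le_top (le_of_eq (Eq.symm ?_))
    refine ENNReal.sum_eq_top.2 ⟨0, by simpa using hm, ?_⟩
    rw [add_zero, h, ← hzφ, rieszKernel_self hs]
  · rw [sum_unityRoots s z (j + 1)]
    have hmem : ∀ i < m, 0 < 2 * Real.pi * (j + 1 + i : ℕ) / m - φ ∧
        2 * Real.pi * (j + 1 + i : ℕ) / m < φ + 2 * Real.pi := by
      intro i hi
      have hi' : (i : ℝ) + 1 ≤ m := by exact_mod_cast hi
      rw [lt_div_iff₀ hm'] at hj2
      rw [div_lt_iff₀ hm'] at h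
      push_cast
      constructor
      · rw [sub_pos, lt_div_iff₀ hm']
        nlinarith [mul_nonneg hπ.le (Nat.cast_nonneg (α := ℝ) i)]
      · rw [div_lt_iff₀ hm']
        nlinarith
    have hker : ∀ i ∈ Finset.range m, rieszKernel s z
        (Complex.exp ((2 * Real.pi * (j + 1 + i : ℕ) / m : ℝ) * Complex.I)) =
        ENNReal.ofReal (circleKernel s (2 * Real.pi * (j + 1 + i : ℕ) / m - φ)) := by
      intro i hi
      nth_rewrite 1 [hzφ]
      exact rieszKernel_exp s (by linarith [(hmem i (Finset.mem_range.1 hi)).1])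
        (hmem i (Finset.mem_range.1 hi)).2
    rw [Finset.sum_congr rfl hker]
    rw [← ENNReal.ofReal_sum_of_nonneg fun i hi => (circleKernel_pos s
      (hmem i (Finset.mem_range.1 hi)).1
      (by linarith [(hmem i (Finset.mem_range.1 hi)).2])).le]
    refine ENNReal.ofReal_le_ofReal ?_
    refine (midpointSum_le hs (t := 2 * Real.pi * (j + 1) / m - φ) (by linarith) ?_).trans
      (le_of_eq (Finset.sum_congr rfl fun i _ => ?_))
    · have : 2 * Real.pi * (j + 1) / m = 2 * Real.pi * j / m + 2 * Real.pi / m := by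
        field_simp
      linarith
    · congr 1
      push_cast
      field_simp
      ring

theorem rieszPolarization_unityRoots {s : ℝ} (hs : 0 < s) {m : ℕ} (hm : 0 < m) :
    rieszPolarization s (unityRoots m) planeCircle = ENNReal.ofReal (midpointSum s m) :=
  le_antisymm (rieszPolarization_le hs hm (unityRoots_mem m))
    (le_iInf₂ fun _ hz => midpointSum_le_sum_unityRoots hs hm hz)

theorem rieszMaxPolarization_planeCircle {s : ℝ} (hs : 0 < s) {m : ℕ} (hm : 0 < m) :
    rieszMaxPolarization s m planeCircle = ENNReal.ofReal (midpointSum s m) :=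
  le_antisymm (iSup₂_le fun _ ha => rieszPolarization_le hs hm ha)
    ((rieszPolarization_unityRoots hs hm).symm.le.trans
      (le_iSup₂ (f := fun (a : Fin m → ℂ) (_ : ∀ j, a j ∈ planeCircle) =>
        rieszPolarization s a planeCircle) (unityRoots m) (unityRoots_mem m)))

/-! ### The best constant in terms of the midpoint sum. -/

theorem midpointSum_nonneg (s : ℝ) (m : ℕ) : 0 ≤ midpointSum s m :=
  Finset.sum_nonneg fun _ hi => (circleKernel_pos s (midpoint_mem (Finset.mem_range.1 hi)).1
    (midpoint_mem (Finset.mem_range.1 hi)).2).le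

theorem iInf_rieszKernel_planeCircle {s : ℝ} (hs : 0 < s) {a : ℂ} (ha : a ∈ planeCircle) :
    ⨅ x ∈ planeCircle, rieszKernel s x a = ENNReal.ofReal (2 ^ (-s)) := by
  have ha' : ‖a‖ = 1 := by simpa [planeCircle] using ha
  rw [← ENNReal.ofReal_rpow_of_pos two_pos]
  refine le_antisymm ((iInf₂_le (-a) (by simpa [planeCircle] using ha')).trans (le_of_eq ?_))
    (le_iInf₂ fun x hx => ?_)
  · rw [rieszKernel, edist_dist, dist_eq_norm, show -a - a = -(2 * a) by ring, norm_neg, norm_mul,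
      ha']
    simp
  · have hx' : ‖x‖ = 1 := by simpa [planeCircle] using hx
    rw [rieszKernel, ENNReal.rpow_neg, ENNReal.rpow_neg, ENNReal.inv_le_inv]
    refine ENNReal.rpow_le_rpow ?_ hs.le
    rw [edist_dist, dist_eq_norm]
    refine ENNReal.ofReal_le_ofReal ((norm_sub_le _ _).trans ?_)
    rw [ha', hx']; norm_num

/-- The mean of the separate infima is 2^(α-2) for every configuration, so only the polarization
varies; the roots of unity show that no larger constant is admissible. -/
theorem isGreatest_pointMassConstants {α : ℝ} (hα : α < 2) {m : ℕ} (hm : 0 < m) :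
    IsGreatest (pointMassConstants α m planeCircle)
      (2 ^ (α - 2) - midpointSum (2 - α) m / m) := by
  have hs : 0 < 2 - α := by linarith
  have hm' : (0 : ℝ) < m := by exact_mod_cast hm
  have hleft : ∀ a : Fin m → ℂ, (∀ j, a j ∈ planeCircle) →
      (((∑ j, ⨅ x ∈ planeCircle, rieszKernel (2 - α) x (a j)) / (m : ℝ≥0∞) : ℝ≥0∞) : EReal) =
        ((2 ^ (α - 2) : ℝ) : EReal) := by
    intro a ha
    rw [Finset.sum_congr rfl fun j _ => iInf_rieszKernel_planeCircle hs (ha j), neg_sub,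
      Finset.sum_const, Finset.card_univ, Fintype.card_fin, nsmul_eq_mul, mul_comm,
      ENNReal.mul_div_cancel_right (by exact_mod_cast hm.ne') (by simp)]
    rw [EReal.coe_ennreal_ofReal, max_eq_left (by positivity)]
  have hdiv : (((ENNReal.ofReal (midpointSum (2 - α) m)) / (m : ℝ≥0∞) : ℝ≥0∞) : EReal) =
      ((midpointSum (2 - α) m / m : ℝ) : EReal) := by
    rw [← ENNReal.ofReal_natCast m, ← ENNReal.ofReal_div_of_pos hm', EReal.coe_ennreal_ofReal,
      max_eq_left (div_nonneg (midpointSum_nonneg _ _) hm'.le)]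
  constructor
  · intro a ha
    rw [hleft a ha]
    have h := rieszPolarization_le hs hm ha
    have h2 : (((⨅ x ∈ planeCircle, ∑ j, rieszKernel (2 - α) x (a j)) / (m : ℝ≥0∞) : ℝ≥0∞) :
        EReal) ≤ ((midpointSum (2 - α) m / m : ℝ) : EReal) := by
      rw [← hdiv]
      exact EReal.coe_ennreal_le_coe_ennreal_iff.2 (ENNReal.div_le_div_right h _)
    refine (add_le_add_right h2 _).trans (le_of_eq ?_)
    rw [← EReal.coe_add, sub_add_cancel]
  · intro C hC
    have h := hC (unityRoots m) (unityRoots_mem m)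
    have h2 := rieszPolarization_unityRoots hs hm
    rw [rieszPolarization] at h2
    rw [hleft _ (unityRoots_mem m), h2, hdiv, ← EReal.coe_add, EReal.coe_le_coe_iff] at h
    linarith

theorem pointMassConstant_eq {α : ℝ} (hα : α < 2) {m : ℕ} (hm : 0 < m) :
    pointMassConstant α m planeCircle = 2 ^ (α - 2) - midpointSum (2 - α) m / m :=
  (isGreatest_pointMassConstants hα hm).csSup_eq

/-! ### Asymptotics for α < 1. -/

/-- Folding at π leaves only angles in (0, π], where sin(θ/2) is bounded below linearly and the
kernel is antitone. For odd m the node at π itself belongs to the first sum. -/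
theorem midpointSum_eq_add (s : ℝ) (m : ℕ) :
    midpointSum s m =
      ∑ i ∈ Finset.range ((m + 1) / 2), circleKernel s (Real.pi * (2 * i + 1) / m) +
      ∑ i ∈ Finset.range (m / 2), circleKernel s (Real.pi * (2 * i + 1) / m) := by
  rcases Nat.eq_zero_or_pos m with rfl | hm
  · simp [midpointSum]
  have hm' : (m : ℝ) ≠ 0 := by positivity
  have hsplit := Finset.sum_range_add
    (fun i : ℕ => circleKernel s (Real.pi * (2 * i + 1) / m)) ((m + 1) / 2) (m / 2)
  rw [show (m + 1) / 2 + m / 2 = m by omega] at hsplit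
  rw [midpointSum, hsplit]
  congr 1
  rw [← Finset.sum_range_reflect]
  refine Finset.sum_congr rfl fun i hi => ?_
  have hi : i < m / 2 := Finset.mem_range.1 hi
  rw [← circleKernel_symm]
  congr 1
  rw [show (m + 1) / 2 + (m / 2 - 1 - i) = m - (1 + i) by omega, Nat.cast_sub (by omega)]
  push_cast
  field_simp
  ring

theorem angle_le_pi {m i : ℕ} (hi : 2 * i + 1 ≤ m) : Real.pi * (2 * i + 1) / m ≤ Real.pi := by
  have hm : (0 : ℝ) < m := by exact_mod_cast (by omega : 0 < m)
  have : (2 * i + 1 : ℝ) ≤ m := by exact_mod_cast hi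
  rw [div_le_iff₀ hm]
  exact mul_le_mul_of_nonneg_left this Real.pi_pos.le

theorem tendsto_natCast_mul_sin_div (c : ℝ) :
    Tendsto (fun m : ℕ => (m : ℝ) * Real.sin (c / m)) atTop (𝓝 c) := by
  have h1 : Tendsto (fun m : ℕ => c / (m : ℝ)) atTop (𝓝 0) :=
    tendsto_const_div_atTop_nhds_zero_nat c
  have h2 := ((Real.continuous_sinc.tendsto 0).comp h1).const_mul c
  rw [Real.sinc_zero, mul_one] at h2
  refine h2.congr' ?_
  filter_upwards [eventually_gt_atTop 0] with m hm
  have hm' : (m : ℝ) ≠ 0 := by positivity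
  rcases eq_or_ne c 0 with rfl | hc
  · simp
  · rw [Function.comp, Real.sinc_of_ne_zero (by positivity)]
    field_simp

theorem circleKernel_div_rpow (s : ℝ) {m i : ℕ} (hi : i < m) :
    circleKernel s (Real.pi * (2 * i + 1) / m) / (m : ℝ) ^ s =
      (2 * (m * Real.sin (Real.pi * (2 * i + 1) / 2 / m))) ^ (-s) := by
  have hm : (0 : ℝ) < m := by exact_mod_cast (by omega : 0 < m)
  have h := two_mul_sin_half_pos (midpoint_mem hi).1 (midpoint_mem hi).2
  rw [circleKernel, div_right_comm _ (m : ℝ), div_eq_mul_inv _ ((m : ℝ) ^ s),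
    ← Real.rpow_neg hm.le, ← Real.mul_rpow]
  · congr 1; ring
  · rw [div_right_comm]; exact h.le
  · exact hm.le

theorem summable_nat_add_one_rpow_neg {s : ℝ} (hs : 1 < s) :
    Summable fun i : ℕ => ((i : ℝ) + 1) ^ (-s) := by
  have h : Summable fun i : ℕ => (i : ℝ) ^ (-s) := Real.summable_nat_rpow.2 (by linarith)
  simpa using (summable_nat_add_iff 1).2 h

/-- Dominated convergence for series: m sin(c/m) → c gives the termwise limit, and Jordan's
inequality sin x ≥ 2x/π the summable majorant (i+1)^(-s). The cutoff q covers both halves of the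
folded sum. -/
theorem tendsto_sum_circleKernel_div_rpow {s : ℝ} (hs : 1 < s) {q : ℕ → ℕ}
    (hq : ∀ m, q m ≤ (m + 1) / 2) (hq' : Tendsto q atTop atTop) :
    Tendsto (fun m : ℕ => (∑ i ∈ Finset.range (q m),
        circleKernel s (Real.pi * (2 * i + 1) / m)) / (m : ℝ) ^ s) atTop
      (𝓝 (∑' i : ℕ, (Real.pi * (2 * i + 1)) ^ (-s))) := by
  have hπ := Real.pi_pos
  have hsum : ∀ m : ℕ, (∑ i ∈ Finset.range (q m),
      circleKernel s (Real.pi * (2 * i + 1) / m)) / (m : ℝ) ^ s =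
      ∑' i : ℕ, if i < q m then circleKernel s (Real.pi * (2 * i + 1) / m) / (m : ℝ) ^ s else 0 := by
    intro m
    rw [tsum_eq_sum (s := Finset.range (q m)) fun i hi => if_neg (by simpa using hi),
      Finset.sum_div]
    exact Finset.sum_congr rfl fun i hi => (if_pos (Finset.mem_range.1 hi)).symm
  simp only [hsum]
  refine tendsto_tsum_of_dominated_convergence (summable_nat_add_one_rpow_neg hs) ?_ ?_
  · intro i
    have h1 : Tendsto (fun m : ℕ => 2 * ((m : ℝ) * Real.sin (Real.pi * (2 * i + 1) / 2 / m))) atTop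
        (𝓝 (Real.pi * (2 * i + 1))) := by
      have := (tendsto_natCast_mul_sin_div (Real.pi * (2 * i + 1) / 2)).const_mul 2
      rwa [mul_div_cancel₀ _ two_ne_zero] at this
    refine (h1.rpow_const (p := -s) (Or.inl (by positivity))).congr' ?_
    filter_upwards [hq'.eventually_gt_atTop i] with m hm
    have := hq m
    rw [if_pos hm, circleKernel_div_rpow s (by omega)]
  · refine Eventually.of_forall fun m i => ?_
    split_ifs with hi
    · have h0 := hq m
      have him : 2 * i + 1 ≤ m := by omega
      have hm : (0 : ℝ) < m := by exact_mod_cast (by omega : 0 < m)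
      rw [circleKernel_div_rpow s (by omega)]
      have h1 := angle_le_pi him
      have h2 := Real.mul_le_sin (x := Real.pi * (2 * i + 1) / 2 / m) (by positivity)
        (by rw [div_right_comm]; linarith)
      have h3 : 2 / Real.pi * (Real.pi * (2 * i + 1) / 2 / m) = (2 * i + 1) / m := by field_simp
      rw [h3, div_le_iff₀ hm, mul_comm (Real.sin _)] at h2
      have h4 : (i : ℝ) + 1 ≤ 2 * (m * Real.sin (Real.pi * (2 * i + 1) / 2 / m)) := by
        have : (0 : ℝ) ≤ i := by positivity
        linarith
      have h5 : (0 : ℝ) < (i : ℝ) + 1 := by positivity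
      rw [Real.norm_of_nonneg (Real.rpow_nonneg (h5.le.trans h4) _)]
      exact Real.rpow_le_rpow_of_nonpos h5 h4 (by linarith)
    · rw [norm_zero]; positivity

theorem riemannZeta_re_eq_tsum {s : ℝ} (hs : 1 < s) :
    (riemannZeta (s : ℂ)).re = ∑' n : ℕ, (n : ℝ) ^ (-s) := by
  rw [zeta_eq_tsum_one_div_nat_cpow (by simpa using hs)]
  have : ∀ n : ℕ, 1 / (n : ℂ) ^ (s : ℂ) = (((n : ℝ) ^ (-s) : ℝ) : ℂ) := by
    intro n
    rw [Real.rpow_neg (by positivity), Complex.ofReal_inv, Complex.ofReal_cpow (by positivity),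
      one_div, Complex.ofReal_natCast]
  simp only [this]
  rw [← Complex.ofReal_tsum, Complex.ofReal_re]

theorem tsum_odd_rpow_neg {s : ℝ} (hs : 1 < s) :
    ∑' i : ℕ, (2 * (i : ℝ) + 1) ^ (-s) = (1 - 2 ^ (-s)) * (riemannZeta (s : ℂ)).re := by
  have hsum : Summable fun i : ℕ => (i : ℝ) ^ (-s) := Real.summable_nat_rpow.2 (by linarith)
  have h := tsum_even_add_odd (f := fun n : ℕ => (n : ℝ) ^ (-s))
    (hsum.comp_injective (i := fun k => 2 * k) fun a b h => by simpa using h)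
    (hsum.comp_injective (i := fun k => 2 * k + 1) fun a b h => by simpa using h)
  rw [riemannZeta_re_eq_tsum hs]
  have he : ∀ k : ℕ, ((2 * k : ℕ) : ℝ) ^ (-s) = 2 ^ (-s) * (k : ℝ) ^ (-s) := by
    intro k
    rw [Nat.cast_mul, Real.mul_rpow (by positivity) (by positivity)]
    norm_num
  simp only [he, tsum_mul_left] at h
  push_cast at h
  linarith

theorem tendsto_midpointSum_div_rpow {s : ℝ} (hs : 1 < s) :
    Tendsto (fun m : ℕ => midpointSum s m / (m : ℝ) ^ s) atTop
      (𝓝 (2 * (riemannZeta (s : ℂ)).re / (2 * Real.pi) ^ s * (2 ^ s - 1))) := by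
  have hπ := Real.pi_pos
  have h1 := tendsto_sum_circleKernel_div_rpow hs (q := fun m => (m + 1) / 2) (fun _ => le_rfl)
    (tendsto_atTop_atTop.2 fun b => ⟨2 * b, fun a ha => by omega⟩)
  have h2 := tendsto_sum_circleKernel_div_rpow hs (q := fun m => m / 2) (fun _ => by omega)
    (tendsto_atTop_atTop.2 fun b => ⟨2 * b, fun a ha => by omega⟩)
  have h3 : ∑' i : ℕ, (Real.pi * (2 * i + 1)) ^ (-s) +
      ∑' i : ℕ, (Real.pi * (2 * i + 1)) ^ (-s) =
      2 * (riemannZeta (s : ℂ)).re / (2 * Real.pi) ^ s * (2 ^ s - 1) := by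
    have : ∀ i : ℕ, (Real.pi * (2 * i + 1)) ^ (-s) = Real.pi ^ (-s) * (2 * (i : ℝ) + 1) ^ (-s) :=
      fun i => Real.mul_rpow hπ.le (by positivity)
    simp only [this, tsum_mul_left, tsum_odd_rpow_neg hs]
    rw [Real.mul_rpow two_pos.le hπ.le, Real.rpow_neg hπ.le, Real.rpow_neg two_pos.le]
    field_simp
    ring
  rw [← h3]
  refine (h1.add h2).congr fun m => ?_
  rw [midpointSum_eq_add, add_div]

theorem riemannZeta_re_pos {s : ℝ} (hs : 1 < s) : 0 < (riemannZeta (s : ℂ)).re := by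
  rw [riemannZeta_re_eq_tsum hs]
  have hsum : Summable fun i : ℕ => (i : ℝ) ^ (-s) := Real.summable_nat_rpow.2 (by linarith)
  exact hsum.tsum_pos (fun i => by positivity) 1 (by simp)

theorem tendsto_pointMassConstant_div_of_lt_one {α : ℝ} (hα : α < 1) :
    Tendsto (fun m : ℕ => pointMassConstant α m planeCircle /
          (-(2 * (riemannZeta ((2 - α : ℝ) : ℂ)).re / (2 * Real.pi) ^ (2 - α)
            * ((2 : ℝ) ^ (2 - α) - 1) * (m : ℝ) ^ (1 - α))))
        atTop (𝓝 1) := by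
  have hs : 1 < 2 - α := by linarith
  have hlim := tendsto_midpointSum_div_rpow hs
  set L := 2 * (riemannZeta ((2 - α : ℝ) : ℂ)).re / (2 * Real.pi) ^ (2 - α) *
    ((2 : ℝ) ^ (2 - α) - 1) with hL
  have hLpos : 0 < L := by
    have h1 := riemannZeta_re_pos hs
    have h2 : (1 : ℝ) < 2 ^ (2 - α) := Real.one_lt_rpow one_lt_two (by linarith)
    have h3 : (0 : ℝ) < 2 ^ (2 - α) - 1 := by linarith
    have := Real.pi_pos
    positivity
  have h0 : Tendsto (fun m : ℕ => (m : ℝ) ^ (-(1 - α))) atTop (𝓝 0) :=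
    (tendsto_rpow_neg_atTop (by linarith)).comp tendsto_natCast_atTop_atTop
  have h := (hlim.div_const L).sub ((h0.const_mul (2 ^ (α - 2))).div_const L)
  rw [div_self hLpos.ne', mul_zero, zero_div, sub_zero] at h
  refine h.congr' ?_
  filter_upwards [eventually_gt_atTop 0] with m hm
  have hm' : (0 : ℝ) < m := by exact_mod_cast hm
  rw [pointMassConstant_eq (by linarith) hm, Real.rpow_neg hm'.le,
    show (2 - α) = (1 - α) + 1 by ring, Real.rpow_add_one hm'.ne']
  have := (Real.rpow_pos_of_pos hm' (1 - α)).ne'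
  field_simp
  ring

/-! ### Asymptotics for α = 1. -/

/-- From x cos x ≤ sin x and cos x ≥ 1 − x²/2, the difference x − sin x is at most x³/2. This is at
most x² ≤ 2x sin x, because x ≤ π/2 ≤ 2 and sin x ≥ x/2. -/
theorem inv_sin_le {x : ℝ} (h0 : 0 < x) (h1 : x ≤ Real.pi / 2) :
    (Real.sin x)⁻¹ ≤ x⁻¹ + 2 := by
  have hπ := Real.pi_pos
  have hπ4 := Real.pi_le_four
  have hsin : 2 / Real.pi * x ≤ Real.sin x := Real.mul_le_sin h0.le h1
  have hsin0 : 0 < Real.sin x := lt_of_lt_of_le (by positivity) hsin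
  have hx : x * Real.cos x ≤ Real.sin x := by
    rcases h1.eq_or_lt with h | h
    · rw [h, Real.cos_pi_div_two, Real.sin_pi_div_two]; norm_num
    · have hc := Real.cos_pos_of_mem_Ioo ⟨by linarith, h⟩
      have := Real.le_tan h0.le h
      rwa [Real.tan_eq_sin_div_cos, le_div_iff₀ hc] at this
  have hcos := Real.one_sub_sq_div_two_le_cos (x := x)
  have h2 : x / 2 ≤ Real.sin x := by
    refine le_trans ?_ hsin
    rw [div_mul_eq_mul_div, div_le_div_iff₀ two_pos hπ]
    nlinarith
  have h3 : x - Real.sin x ≤ 2 * (x * Real.sin x) := by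
    nlinarith [mul_le_mul_of_nonneg_left hcos h0.le, mul_le_mul_of_nonneg_left h2 h0.le,
      mul_pos h0 h0]
  rw [inv_le_iff_one_le_mul₀ hsin0]
  have h4 : (x⁻¹ + 2) * Real.sin x = (Real.sin x + 2 * (x * Real.sin x)) / x := by
    field_simp
  rw [h4, le_div_iff₀ h0]
  linarith

theorem circleKernel_one_bounds {m i : ℕ} (hi : 2 * i + 1 ≤ m) :
    1 / (Real.pi * (2 * i + 1)) ≤ circleKernel 1 (Real.pi * (2 * i + 1) / m) / m ∧
    circleKernel 1 (Real.pi * (2 * i + 1) / m) / m ≤ 1 / (Real.pi * (2 * i + 1)) + 1 / m := by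
  have hπ := Real.pi_pos
  have hm : (0 : ℝ) < m := by exact_mod_cast (by omega : 0 < m)
  have h1 := angle_le_pi hi
  have hx0 : 0 < Real.pi * (2 * i + 1) / m / 2 := by positivity
  have hsin : 0 < Real.sin (Real.pi * (2 * i + 1) / m / 2) :=
    Real.sin_pos_of_pos_of_lt_pi hx0 (by linarith)
  have hker : circleKernel 1 (Real.pi * (2 * i + 1) / m) / m =
      (Real.sin (Real.pi * (2 * i + 1) / m / 2))⁻¹ / (2 * m) := by
    rw [circleKernel, Real.rpow_neg_one]
    field_simp
  have hx : (Real.pi * (2 * i + 1) / m / 2)⁻¹ / (2 * m) = 1 / (Real.pi * (2 * i + 1)) := by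
    field_simp
  rw [hker, ← hx]
  constructor
  · gcongr
    exact Real.sin_le hx0.le
  · have := inv_sin_le hx0 (by linarith)
    calc _ ≤ ((Real.pi * (2 * i + 1) / m / 2)⁻¹ + 2) / (2 * m) := by gcongr
      _ = _ := by rw [add_div]; congr 1; field_simp

theorem harmonic_cast_eq (n : ℕ) :
    ((harmonic n : ℚ) : ℝ) = ∑ i ∈ Finset.range n, 1 / ((i : ℝ) + 1) := by
  simp [harmonic]

theorem midpointSum_one_div_ge {m : ℕ} (hm : 0 < m) :
    1 / Real.pi * (Real.log m - Real.log 2) ≤ midpointSum 1 m / m := by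
  have hπ := Real.pi_pos
  have hm' : (0 : ℝ) < m := by exact_mod_cast hm
  -- Each half contributes (log m)/(2π) up to a constant, through 2i + 1 ≤ 2(i + 1) and the
  -- logarithmic lower bound for harmonic numbers.
  have hlow : ∀ q, q ≤ (m + 1) / 2 → 1 / (2 * Real.pi) * Real.log (q + 1) ≤
      (∑ i ∈ Finset.range q, circleKernel 1 (Real.pi * (2 * i + 1) / m)) / m := by
    intro q hq
    have h1 := log_add_one_le_harmonic q
    rw [harmonic_cast_eq] at h1
    push_cast at h1
    refine (mul_le_mul_of_nonneg_left h1 (by positivity)).trans ?_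
    rw [Finset.mul_sum, Finset.sum_div]
    refine Finset.sum_le_sum fun i hi => ?_
    have hi := Finset.mem_range.1 hi
    refine le_trans ?_ (circleKernel_one_bounds (m := m) (by omega)).1
    rw [one_div_mul_one_div]
    refine one_div_le_one_div_of_le (by positivity) ?_
    nlinarith
  have hlog : ∀ q, m / 2 ≤ q → Real.log m - Real.log 2 ≤ Real.log (q + 1) := by
    intro q hq
    rw [← Real.log_div hm'.ne' two_ne_zero]
    refine Real.log_le_log (by positivity) ?_
    rw [div_le_iff₀ two_pos]
    exact_mod_cast (by omega : m ≤ (q + 1) * 2)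
  have h1 := hlow _ le_rfl
  have h2 := hlow (m / 2) (by omega)
  have h3 := mul_le_mul_of_nonneg_left (hlog ((m + 1) / 2) (by omega))
    (by positivity : 0 ≤ 1 / (2 * Real.pi))
  have h4 := mul_le_mul_of_nonneg_left (hlog (m / 2) le_rfl)
    (by positivity : 0 ≤ 1 / (2 * Real.pi))
  rw [midpointSum_eq_add, add_div]
  have h5 : 1 / Real.pi = 1 / (2 * Real.pi) + 1 / (2 * Real.pi) := by field_simp; norm_num
  rw [h5]
  linarith

theorem sum_one_div_odd_le (n : ℕ) :
    ∑ i ∈ Finset.range n, 1 / (2 * (i : ℝ) + 1) ≤ 1 + (harmonic n : ℚ) / 2 := by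
  -- With one more term, the induction compares 1/(2k+1) with 1/(2k) for k ≥ 1, and the leading 1
  -- accounts for i = 0.
  have h : ∑ i ∈ Finset.range (n + 1), 1 / (2 * (i : ℝ) + 1) ≤ 1 + (harmonic n : ℚ) / 2 := by
    induction n with
    | zero => simp
    | succ n ih =>
      rw [Finset.sum_range_succ, harmonic_succ]
      have : 1 / (2 * ((n + 1 : ℕ) : ℝ) + 1) ≤ ((n + 1 : ℕ) : ℝ)⁻¹ / 2 := by
        rw [inv_eq_one_div, div_div]
        exact one_div_le_one_div_of_le (by positivity) (by linarith)
      push_cast at this ih ⊢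
      linarith
  refine le_trans ?_ h
  rw [Finset.sum_range_succ]
  have : (0 : ℝ) ≤ 1 / (2 * (n : ℝ) + 1) := by positivity
  linarith

theorem midpointSum_one_div_le {m : ℕ} (hm : 0 < m) :
    midpointSum 1 m / m ≤ 1 / Real.pi * Real.log m + (3 / Real.pi + 1) := by
  have hπ := Real.pi_pos
  have hm' : (0 : ℝ) < m := by exact_mod_cast hm
  have hup : ∀ q, q ≤ (m + 1) / 2 →
      (∑ i ∈ Finset.range q, circleKernel 1 (Real.pi * (2 * i + 1) / m)) / m ≤
      1 / Real.pi * (3 / 2 + Real.log m / 2) + q / m := by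
    intro q hq
    have hlog : Real.log q ≤ Real.log m := by
      rcases Nat.eq_zero_or_pos q with rfl | hq0
      · simpa using Real.log_natCast_nonneg m
      · exact Real.log_le_log (by exact_mod_cast hq0) (by exact_mod_cast (by omega : q ≤ m))
    have h1 := harmonic_le_one_add_log q
    have h2 := sum_one_div_odd_le q
    calc _ ≤ ∑ i ∈ Finset.range q, (1 / Real.pi * (1 / (2 * (i : ℝ) + 1)) + 1 / m) := by
          rw [Finset.sum_div]
          refine Finset.sum_le_sum fun i hi => ?_
          have hi := Finset.mem_range.1 hi
          rw [one_div_mul_one_div]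
          exact (circleKernel_one_bounds (m := m) (by omega)).2
      _ = 1 / Real.pi * ∑ i ∈ Finset.range q, 1 / (2 * (i : ℝ) + 1) + q / m := by
          rw [Finset.sum_add_distrib, ← Finset.mul_sum, Finset.sum_const, Finset.card_range,
            nsmul_eq_mul, mul_one_div]
      _ ≤ _ := by
          gcongr
          linarith
  have h1 := hup _ le_rfl
  have h2 := hup (m / 2) (by omega)
  have h3 : (((m + 1) / 2 : ℕ) : ℝ) / m + ((m / 2 : ℕ) : ℝ) / m = 1 := by
    rw [← add_div, div_eq_one_iff_eq hm'.ne']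
    exact_mod_cast (by omega : (m + 1) / 2 + m / 2 = m)
  rw [midpointSum_eq_add, add_div]
  have h4 : 1 / Real.pi * (3 / 2 + Real.log m / 2) + 1 / Real.pi * (3 / 2 + Real.log m / 2) =
    1 / Real.pi * Real.log m + 3 / Real.pi := by ring
  linarith

theorem tendsto_pointMassConstant_one_div :
    Tendsto (fun m : ℕ => pointMassConstant 1 m planeCircle /
          (-(1 / Real.pi * Real.log (m : ℝ)))) atTop (𝓝 1) := by
  have hπ := Real.pi_pos
  have hlog : Tendsto (fun m : ℕ => Real.log (m : ℝ)) atTop atTop :=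
    Real.tendsto_log_atTop.comp tendsto_natCast_atTop_atTop
  have hc : ∀ c : ℝ, Tendsto (fun m : ℕ => 1 + c / Real.log (m : ℝ)) atTop (𝓝 1) := fun c => by
    simpa using (hlog.const_div_atTop c).const_add 1
  refine tendsto_of_tendsto_of_tendsto_of_le_of_le' (hc (-(Real.log 2 + Real.pi * 2 ^ (-1 : ℝ))))
    (hc (3 + Real.pi)) ?_ ?_
  all_goals
    filter_upwards [eventually_gt_atTop 0, hlog.eventually_gt_atTop 0] with m hm hl
    have hlow := mul_le_mul_of_nonneg_left (midpointSum_one_div_ge hm) hπ.le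
    have hup := mul_le_mul_of_nonneg_left (midpointSum_one_div_le hm) hπ.le
    have e1 : Real.pi * (1 / Real.pi * (Real.log m - Real.log 2)) = Real.log m - Real.log 2 := by
      field_simp
    have e2 : Real.pi * (1 / Real.pi * Real.log m + (3 / Real.pi + 1)) =
      Real.log m + (3 + Real.pi) := by field_simp
    have e3 : pointMassConstant 1 m planeCircle / (-(1 / Real.pi * Real.log (m : ℝ))) =
        (Real.pi * (midpointSum 1 m / m) - Real.pi * 2 ^ (-1 : ℝ)) / Real.log m := by
      rw [pointMassConstant_eq (by norm_num) hm, show (2 : ℝ) - 1 = 1 by norm_num,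
        show (1 : ℝ) - 2 = -1 by norm_num]
      field_simp
      ring
    rw [e1] at hlow
    rw [e2] at hup
    have e4 : ∀ c : ℝ, 1 + c / Real.log m = (Real.log m + c) / Real.log m := fun c => by
      field_simp
    rw [e3, e4]
    gcongr
    have : 0 < Real.pi * (2 : ℝ) ^ (-1 : ℝ) := by positivity
    linarith

/-! ### The mean of the kernel as a Beta integral. -/

/-- The mean value over the unit circle of the Riesz kernel with a fixed pole. -/
noncomputable def circleMean (s : ℝ) : ℝ :=
  (∫ θ in (0 : ℝ)..2 * Real.pi, circleKernel s θ) / (2 * Real.pi)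

theorem image_one_sub_cos_half :
    (fun θ : ℝ => (1 - Real.cos (θ / 2)) / 2) '' Set.Ioo 0 (2 * Real.pi) = Set.Ioo 0 1 := by
  ext x
  constructor
  · rintro ⟨θ, ⟨h0, h1⟩, rfl⟩
    have hs := Real.sin_pos_of_pos_of_lt_pi (x := θ / 2) (by linarith) (by linarith)
    have := Real.sin_sq_add_cos_sq (θ / 2)
    constructor <;> simp only <;> nlinarith [sq_nonneg (Real.cos (θ / 2))]
  · rintro ⟨h0, h1⟩
    refine ⟨2 * Real.arccos (1 - 2 * x), ⟨?_, ?_⟩, ?_⟩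
    · have := Real.arccos_pos.2 (by linarith : 1 - 2 * x < 1)
      linarith
    · have := Real.arccos_lt_pi.2 (by linarith : -1 < 1 - 2 * x)
      linarith
    · simp only [mul_div_cancel_left₀ _ (two_ne_zero (α := ℝ))]
      rw [Real.cos_arccos (by linarith) (by linarith)]
      ring

theorem injOn_one_sub_cos_half :
    Set.InjOn (fun θ : ℝ => (1 - Real.cos (θ / 2)) / 2) (Set.Ioo 0 (2 * Real.pi)) := by
  intro x hx y hy hxy
  have := Real.injOn_cos (x₁ := x / 2) ⟨by linarith [hx.1], by linarith [hx.2]⟩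
    (x₂ := y / 2) ⟨by linarith [hy.1], by linarith [hy.2]⟩ (by simp only at hxy; linarith)
  linarith

/-- For x = (1 − cos(θ/2))/2 and u = 2 sin(θ/2) one has x(1 − x) = u²/16 and dx/dθ = u/8. The
symmetric Beta density with parameter p = (1 − s)/2 therefore pulls back to a multiple of u^(2p−1) =
u^(-s). -/
theorem beta_kernel_eq {s θ : ℝ} (h0 : 0 < θ) (h1 : θ < 2 * Real.pi) (B : ℝ) :
    |Real.sin (θ / 2) / 4| * (1 / B * ((1 - Real.cos (θ / 2)) / 2) ^ ((1 - s) / 2 - 1) *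
      (1 - (1 - Real.cos (θ / 2)) / 2) ^ ((1 - s) / 2 - 1)) =
    circleKernel s θ / (B * 16 ^ ((1 - s) / 2) / 2) := by
  have hu := two_mul_sin_half_pos h0 h1
  have hsc := Real.sin_sq_add_cos_sq (θ / 2)
  have hs : 0 < Real.sin (θ / 2) := by linarith
  set u := 2 * Real.sin (θ / 2) with hudef
  have hprod : (1 - Real.cos (θ / 2)) / 2 * (1 - (1 - Real.cos (θ / 2)) / 2) = u ^ (2 : ℝ) / 16 := by
    rw [Real.rpow_two, hudef]; nlinarith
  rw [abs_of_pos (by linarith), mul_assoc (1 / B), ← Real.mul_rpow (by nlinarith) (by nlinarith),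
    hprod, Real.div_rpow (by positivity) (by norm_num), ← Real.rpow_mul hu.le,
    Real.rpow_sub (by norm_num : (0 : ℝ) < 16), Real.rpow_one, circleKernel, ← hudef,
    show (2 : ℝ) * ((1 - s) / 2 - 1) = -s - 1 by ring, Real.rpow_sub_one hu.ne',
    show Real.sin (θ / 2) = u / 2 by rw [hudef]; ring]
  have : (16 : ℝ) ^ ((1 - s) / 2) ≠ 0 := by positivity
  rcases eq_or_ne B 0 with rfl | hB
  · simp
  field_simp
  norm_num

/-- The total mass of the Beta law, carried to the angle; it yields both the integrability of the
kernel and the value of its integral. -/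
theorem lintegral_circleKernel_div {s : ℝ} (hs : s < 1) :
    ∫⁻ θ in Set.Ioo 0 (2 * Real.pi), ENNReal.ofReal (circleKernel s θ /
      (ProbabilityTheory.beta ((1 - s) / 2) ((1 - s) / 2) * 16 ^ ((1 - s) / 2) / 2)) = 1 := by
  have hp : 0 < (1 - s) / 2 := by linarith
  have h := ProbabilityTheory.lintegral_betaPDF_eq_one hp hp
  rw [ProbabilityTheory.lintegral_betaPDF, ← image_one_sub_cos_half,
    lintegral_image_eq_lintegral_abs_deriv_mul measurableSet_Ioo
      (f' := fun θ => Real.sin (θ / 2) / 4) ?_ injOn_one_sub_cos_half] at h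
  · rw [← h]
    refine setLIntegral_congr_fun measurableSet_Ioo fun θ hθ => ?_
    rw [← ENNReal.ofReal_mul (abs_nonneg _), beta_kernel_eq hθ.1 hθ.2]
  · intro θ _
    have h1 : HasDerivAt (fun θ : ℝ => θ / 2) (1 / 2) θ := (hasDerivAt_id θ).div_const 2
    have h2 := ((h1.cos.const_sub 1).div_const 2).hasDerivWithinAt (s := Set.Ioo 0 (2 * Real.pi))
    refine h2.congr_deriv ?_
    ring

theorem measurable_circleKernel (s : ℝ) : Measurable (circleKernel s) := by
  unfold circleKernel
  fun_prop

theorem beta_const_pos {s : ℝ} (hs : s < 1) :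
    0 < ProbabilityTheory.beta ((1 - s) / 2) ((1 - s) / 2) * 16 ^ ((1 - s) / 2) / 2 := by
  have hp : 0 < (1 - s) / 2 := by linarith
  have := ProbabilityTheory.beta_pos hp hp
  positivity

theorem integrableOn_circleKernel {s : ℝ} (hs : s < 1) :
    IntegrableOn (circleKernel s) (Set.Ioo 0 (2 * Real.pi)) := by
  have hK := beta_const_pos hs
  have h := lintegral_circleKernel_div hs
  set K := ProbabilityTheory.beta ((1 - s) / 2) ((1 - s) / 2) * 16 ^ ((1 - s) / 2) / 2
  have h1 : IntegrableOn (fun θ => circleKernel s θ / K) (Set.Ioo 0 (2 * Real.pi)) := by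
    refine ⟨((measurable_circleKernel s).div_const K).aestronglyMeasurable, ?_⟩
    rw [hasFiniteIntegral_iff_ofReal, h]
    · exact ENNReal.one_lt_top
    · exact (ae_restrict_mem measurableSet_Ioo).mono fun θ hθ =>
        (div_pos (circleKernel_pos s hθ.1 hθ.2) hK).le
  refine (h1.mul_const K).congr (Eventually.of_forall fun θ => ?_)
  simp only
  rw [div_mul_cancel₀ _ hK.ne']

theorem integral_circleKernel {s : ℝ} (hs : s < 1) :
    ∫ θ in (0 : ℝ)..2 * Real.pi, circleKernel s θ =
      ProbabilityTheory.beta ((1 - s) / 2) ((1 - s) / 2) * 16 ^ ((1 - s) / 2) / 2 := by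
  have hK := beta_const_pos hs
  have h := lintegral_circleKernel_div hs
  set K := ProbabilityTheory.beta ((1 - s) / 2) ((1 - s) / 2) * 16 ^ ((1 - s) / 2) / 2
  rw [intervalIntegral.integral_of_le (by linarith [Real.pi_pos]), integral_Ioc_eq_integral_Ioo]
  have h2 : ∫ θ in Set.Ioo 0 (2 * Real.pi), circleKernel s θ / K = 1 := by
    rw [integral_eq_lintegral_of_nonneg_ae _
      ((measurable_circleKernel s).div_const K).aestronglyMeasurable, h, ENNReal.toReal_one]
    exact (ae_restrict_mem measurableSet_Ioo).mono fun θ hθ =>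
        (div_pos (circleKernel_pos s hθ.1 hθ.2) hK).le
  rwa [integral_div, div_eq_one_iff_eq hK.ne'] at h2

theorem intervalIntegrable_circleKernel {s : ℝ} (hs : s < 1) :
    IntervalIntegrable (circleKernel s) volume 0 (2 * Real.pi) := by
  rw [intervalIntegrable_iff_integrableOn_Ioo_of_le (by linarith [Real.pi_pos])]
  exact integrableOn_circleKernel hs

/-- Legendre's duplication formula turns Γ(p)²/Γ(2p), with p = (1 − s)/2, into the stated quotient.
-/
theorem circleMean_eq {s : ℝ} (hs : s < 1) :
    circleMean s = 2 ^ (-s) / √Real.pi *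
      (Real.Gamma ((1 - s) / 2) / Real.Gamma ((1 - s) / 2 + 1 / 2)) := by
  have hp : 0 < (1 - s) / 2 := by linarith
  have hπ := Real.pi_pos
  rw [circleMean, integral_circleKernel hs, ProbabilityTheory.beta, ← two_mul,
    show -s = 2 * ((1 - s) / 2) - 1 by ring]
  set p := (1 - s) / 2
  have hG := Real.Gamma_pos_of_pos hp
  have hG2 := Real.Gamma_pos_of_pos (by linarith : 0 < 2 * p)
  have hG3 := Real.Gamma_pos_of_pos (by linarith : 0 < p + 1 / 2)
  have hdup := Real.Gamma_mul_Gamma_add_half p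
  have hsqrt := Real.mul_self_sqrt hπ.le
  have h16 : (16 : ℝ) ^ p = (2 ^ (2 * p)) ^ 2 := by
    rw [← Real.rpow_natCast, ← Real.rpow_mul two_pos.le, show 2 * p * ((2 : ℕ) : ℝ) = 4 * p by
      push_cast; ring, Real.rpow_mul two_pos.le]
    norm_num
  rw [Real.rpow_sub two_pos, Real.rpow_one] at hdup
  rw [Real.rpow_sub two_pos, Real.rpow_one, h16]
  have h2 : (0 : ℝ) < 2 ^ (2 * p) := by positivity
  have hsq : 0 < √Real.pi := Real.sqrt_pos.2 hπ
  set X := (2 : ℝ) ^ (2 * p)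
  set r := √Real.pi
  rw [← hsqrt]
  field_simp at hdup ⊢
  nlinarith

/-! ### Convergence of the midpoint rule and asymptotics for 1 < α < 2. -/

/-- The midpoint rule underestimates the integral of a convex function. -/
theorem midpointSum_div_le_circleMean {s : ℝ} (hs : 0 < s) (hs1 : s < 1) {m : ℕ} (hm : 0 < m) :
    midpointSum s m / m ≤ circleMean s := by
  have hm' : (0 : ℝ) < m := by exact_mod_cast hm
  have hπ := Real.pi_pos
  have hint := intervalIntegrable_circleKernel hs1
  have hend : ∀ i ≤ m, 2 * Real.pi * i / m ∈ Set.Icc 0 (2 * Real.pi) := by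
    intro i hi
    have hi' : (i : ℝ) ≤ m := by exact_mod_cast hi
    refine ⟨by positivity, ?_⟩
    rw [div_le_iff₀ hm']
    exact mul_le_mul_of_nonneg_left hi' (by positivity)
  have hsub : ∀ i < m, IntervalIntegrable (circleKernel s) volume (2 * Real.pi * i / m)
      (2 * Real.pi * (i + 1 : ℕ) / m) := by
    intro i hi
    refine hint.mono_set (Set.uIcc_subset_uIcc ?_ ?_) <;> rw [Set.uIcc_of_le (by positivity)]
    · exact hend i hi.le
    · exact hend (i + 1) hi
  have hshift : ∀ i : ℕ, ∫ t in (0 : ℝ)..2 * Real.pi / m, circleKernel s (t + 2 * Real.pi * i / m) =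
      ∫ t in 2 * Real.pi * i / m..2 * Real.pi * (i + 1 : ℕ) / m, circleKernel s t := by
    intro i
    rw [intervalIntegral.integral_comp_add_right]
    congr 1
    · ring
    · push_cast; ring
  have hshift' : ∀ i < m, IntervalIntegrable (fun t => circleKernel s (t + 2 * Real.pi * i / m))
      volume 0 (2 * Real.pi / m) := by
    intro i hi
    have := (hsub i hi).comp_add_right (2 * Real.pi * i / m)
    convert this using 1
    · ring
    · push_cast; ring
  have hsum := intervalIntegral.sum_integral_adjacent_intervals (f := circleKernel s)
    (μ := volume) (a := fun i : ℕ => 2 * Real.pi * i / m) (n := m) hsub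
  -- The pointwise bound `midpointSum_le` is integrated over the offset t in one cell; the integrals
  -- of the shifted kernels then add up to the full integral.
  have hkey : ∫ t in (0 : ℝ)..2 * Real.pi / m, midpointSum s m ≤
      ∫ t in (0 : ℝ)..2 * Real.pi / m,
        ∑ i ∈ Finset.range m, circleKernel s (t + 2 * Real.pi * i / m) := by
    refine intervalIntegral.integral_mono_on_of_le_Ioo (by positivity) (by simp) ?_ ?_
    · simpa only [Finset.sum_fn] using
        IntervalIntegrable.sum _ fun i hi => hshift' i (Finset.mem_range.1 hi)
    · exact fun t ht => midpointSum_le hs ht.1 ht.2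
  rw [intervalIntegral.integral_finsetSum fun i hi => hshift' i (Finset.mem_range.1 hi),
    Finset.sum_congr rfl fun i _ => hshift i, hsum, intervalIntegral.integral_const] at hkey
  simp only [Nat.cast_zero, mul_zero, zero_div, mul_div_cancel_right₀ _ hm'.ne', smul_eq_mul,
    sub_zero] at hkey
  rw [circleMean, le_div_iff₀ (by positivity)]
  calc _ = 2 * Real.pi / m * midpointSum s m := by ring
    _ ≤ _ := hkey

theorem integral_circleKernel_half {s : ℝ} (hs1 : s < 1) :
    2 * ∫ θ in (0 : ℝ)..Real.pi, circleKernel s θ = ∫ θ in (0 : ℝ)..2 * Real.pi, circleKernel s θ := by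
  have hπ := Real.pi_pos
  have hint := intervalIntegrable_circleKernel hs1
  have h1 : IntervalIntegrable (circleKernel s) volume 0 Real.pi := hint.mono_set
    (Set.uIcc_subset_uIcc (by simp) (by rw [Set.uIcc_of_le (by positivity)]; constructor <;> linarith))
  have h2 : IntervalIntegrable (circleKernel s) volume Real.pi (2 * Real.pi) := hint.mono_set
    (Set.uIcc_subset_uIcc (by rw [Set.uIcc_of_le (by positivity)]; constructor <;> linarith) (by simp))
  rw [← intervalIntegral.integral_add_adjacent_intervals h1 h2]
  have h3 : ∫ θ in Real.pi..2 * Real.pi, circleKernel s θ = ∫ θ in (0 : ℝ)..Real.pi, circleKernel s θ := by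
    have := intervalIntegral.integral_comp_sub_left (a := 0) (b := Real.pi) (circleKernel s)
      (2 * Real.pi)
    simp only [circleKernel_symm] at this
    rw [this]
    congr 1 <;> ring
  rw [h3]; ring

/-- A lower Riemann sum estimate for the antitone half of the kernel. -/
theorem integral_le_sum_circleKernel {s : ℝ} (hs : 0 < s) {h c : ℝ} (hh : 0 < h) (hc : 0 < c) {n : ℕ}
    (hn : h * (c + n) ≤ Real.pi) :
    ∫ θ in h * c..h * (c + n), circleKernel s θ ≤
      h * ∑ i ∈ Finset.range n, circleKernel s (h * (c + i)) := by
  have hanti : AntitoneOn (fun x => circleKernel s (h * x)) (Set.Icc c (c + n)) := by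
    intro x hx y hy hxy
    have h1 : ∀ z ∈ Set.Icc c (c + n), h * z ∈ Set.Ioc 0 Real.pi := fun z hz =>
      ⟨mul_pos hh (by linarith [hz.1]), (mul_le_mul_of_nonneg_left hz.2 hh.le).trans hn⟩
    exact antitoneOn_circleKernel hs (h1 x hx) (h1 y hy) (mul_le_mul_of_nonneg_left hxy hh.le)
  have := hanti.integral_le_sum
  rw [intervalIntegral.integral_comp_mul_left _ hh.ne', smul_eq_mul, inv_mul_le_iff₀ hh] at this
  exact this

/-- The lower bounds of `integral_le_sum_circleKernel` converge to the mean value. -/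
theorem tendsto_integral_circleKernel {s : ℝ} (hs1 : s < 1) (c : ℝ) (hc : 0 ≤ c) (hc1 : c ≤ 1) :
    Tendsto (fun m : ℕ => (∫ θ in 2 * Real.pi / m * c..2 * Real.pi / m * (c + (m / 2 - 1 : ℕ)),
      circleKernel s θ) / Real.pi) atTop (𝓝 (circleMean s)) := by
  have hπ := Real.pi_pos
  have hint : IntervalIntegrable (circleKernel s) volume 0 Real.pi :=
    (intervalIntegrable_circleKernel hs1).mono_set
    (Set.uIcc_subset_uIcc (by simp) (by rw [Set.uIcc_of_le (by positivity)]; constructor <;> linarith))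
  have hcont : ContinuousOn (fun b => ∫ θ in (0 : ℝ)..b, circleKernel s θ) (Set.Icc 0 Real.pi) := by
    have := intervalIntegral.continuousOn_primitive_interval' hint (a := 0) (by simp)
    rwa [Set.uIcc_of_le hπ.le] at this
  -- With n = m/2 − 1 one has 2n + 2 ≤ m ≤ 2n + 3, so for 0 ≤ c ≤ 1 the upper endpoint stays below π
  -- and within 4π/m of it.
  have hbound : ∀ m : ℕ, 2 ≤ m → 2 * Real.pi / m * c ∈ Set.Icc 0 Real.pi ∧
      2 * Real.pi / m * (c + (m / 2 - 1 : ℕ)) ∈ Set.Icc 0 Real.pi ∧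
      Real.pi - 4 * Real.pi / m ≤ 2 * Real.pi / m * (c + (m / 2 - 1 : ℕ)) := by
    intro m hm
    have hm' : (0 : ℝ) < m := by exact_mod_cast (by omega : 0 < m)
    have h1 : 2 * ((m / 2 - 1 : ℕ) : ℝ) + 2 ≤ m := by exact_mod_cast (by omega)
    have h2 : (m : ℝ) ≤ 2 * ((m / 2 - 1 : ℕ) : ℝ) + 3 := by exact_mod_cast (by omega)
    have h3 : (2 : ℝ) ≤ m := by exact_mod_cast hm
    refine ⟨⟨by positivity, ?_⟩, ⟨by positivity, ?_⟩, ?_⟩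
    · rw [div_mul_eq_mul_div, div_le_iff₀ hm']; nlinarith
    · rw [div_mul_eq_mul_div, div_le_iff₀ hm']; nlinarith
    · rw [div_mul_eq_mul_div, sub_le_iff_le_add, ← add_div, le_div_iff₀ hm']; nlinarith
  have ha : Tendsto (fun m : ℕ => 2 * Real.pi / m * c) atTop (𝓝 0) := by
    simpa using (tendsto_const_div_atTop_nhds_zero_nat (2 * Real.pi)).mul_const c
  have hb : Tendsto (fun m : ℕ => 2 * Real.pi / m * (c + (m / 2 - 1 : ℕ))) atTop (𝓝 Real.pi) := by
    have h4 : Tendsto (fun m : ℕ => Real.pi - 4 * Real.pi / m) atTop (𝓝 Real.pi) := by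
      simpa using (tendsto_const_div_atTop_nhds_zero_nat (4 * Real.pi)).const_sub Real.pi
    refine tendsto_of_tendsto_of_tendsto_of_le_of_le' h4 tendsto_const_nhds ?_ ?_
    · filter_upwards [eventually_ge_atTop 2] with m hm using (hbound m hm).2.2
    · filter_upwards [eventually_ge_atTop 2] with m hm using (hbound m hm).2.1.2
  have hA := (hcont 0 ⟨le_rfl, hπ.le⟩).tendsto.comp (tendsto_nhdsWithin_iff.2 ⟨ha, by
    filter_upwards [eventually_ge_atTop 2] with m hm using (hbound m hm).1⟩)
  have hB := (hcont Real.pi ⟨hπ.le, le_rfl⟩).tendsto.comp (tendsto_nhdsWithin_iff.2 ⟨hb, by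
    filter_upwards [eventually_ge_atTop 2] with m hm using (hbound m hm).2.1⟩)
  have hAB := (hB.sub hA).div_const Real.pi
  have hval : ((∫ θ in (0 : ℝ)..Real.pi, circleKernel s θ) -
      ∫ θ in (0 : ℝ)..0, circleKernel s θ) / Real.pi = circleMean s := by
    rw [intervalIntegral.integral_same, sub_zero, circleMean, ← integral_circleKernel_half hs1]
    field_simp
  rw [hval] at hAB
  refine hAB.congr' ?_
  filter_upwards [eventually_ge_atTop 2] with m hm
  obtain ⟨h1, h2, -⟩ := hbound m hm
  have hsub : ∀ b ∈ Set.Icc 0 Real.pi, IntervalIntegrable (circleKernel s) volume 0 b :=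
    fun b hb => hint.mono_set (Set.uIcc_subset_uIcc (by simp) (by rwa [Set.uIcc_of_le hπ.le]))
  rw [Function.comp, Function.comp, intervalIntegral.integral_interval_sub_left (hsub _ h2) (hsub _ h1)]

theorem mesh_mul_le_pi {m : ℕ} (hm : 2 ≤ m) {c : ℝ} (hc1 : c ≤ 1) :
    2 * Real.pi / m * (c + (m / 2 - 1 : ℕ)) ≤ Real.pi := by
  have hm' : (0 : ℝ) < m := by exact_mod_cast (by omega : 0 < m)
  have h1 : 2 * ((m / 2 - 1 : ℕ) : ℝ) + 2 ≤ m := by exact_mod_cast (by omega)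
  rw [div_mul_eq_mul_div, div_le_iff₀ hm']
  nlinarith [Real.pi_pos]

theorem tendsto_midpointSum_div {s : ℝ} (hs : 0 < s) (hs1 : s < 1) :
    Tendsto (fun m : ℕ => midpointSum s m / m) atTop (𝓝 (circleMean s)) := by
  have hπ := Real.pi_pos
  refine tendsto_of_tendsto_of_tendsto_of_le_of_le'
    (tendsto_integral_circleKernel hs1 (1 / 2) (by norm_num) (by norm_num)) tendsto_const_nhds ?_ ?_
  · filter_upwards [eventually_ge_atTop 2] with m hm
    have hm' : (0 : ℝ) < m := by exact_mod_cast (by omega : 0 < m)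
    have h1 := integral_le_sum_circleKernel hs (h := 2 * Real.pi / m) (by positivity)
      (c := 1 / 2) (by norm_num) (mesh_mul_le_pi hm (by norm_num))
    have h2 : ∀ q, m / 2 - 1 ≤ q → q ≤ m →
        ∑ i ∈ Finset.range (m / 2 - 1), circleKernel s (2 * Real.pi / m * (1 / 2 + i)) ≤
        ∑ i ∈ Finset.range q, circleKernel s (Real.pi * (2 * i + 1) / m) := by
      intro q hq hqm
      have h3 : ∀ i : ℕ, 2 * Real.pi / m * (1 / 2 + i) = Real.pi * (2 * i + 1) / m := by
        intro i; field_simp; ring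
      simp only [h3]
      refine Finset.sum_le_sum_of_subset_of_nonneg (Finset.range_mono hq) fun i hi _ => ?_
      have hi := Finset.mem_range.1 hi
      exact (circleKernel_pos s (midpoint_mem (by omega)).1 (midpoint_mem (by omega)).2).le
    have h4 := h2 ((m + 1) / 2) (by omega) (by omega)
    have h5 := h2 (m / 2) (by omega) (by omega)
    rw [midpointSum_eq_add, div_le_div_iff₀ hπ hm']
    rw [div_mul_eq_mul_div (2 * Real.pi) (m : ℝ) (Finset.sum _ _), le_div_iff₀ hm'] at h1
    nlinarith
  · filter_upwards [eventually_ge_atTop 2] with m hm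
    exact midpointSum_div_le_circleMean hs hs1 (by omega)

/-- Strictness makes the limit of the constants nonzero, so that dividing by it is legitimate. The
two-node midpoint rule suffices: its angles π/2 and 3π/2 differ from π, the only angle with chord 2.
-/
theorem two_rpow_neg_lt_circleMean {s : ℝ} (hs : 0 < s) (hs1 : s < 1) :
    2 ^ (-s) < circleMean s := by
  have hπ := Real.pi_pos
  refine lt_of_lt_of_le ?_ (midpointSum_div_le_circleMean hs hs1 (m := 2) (by norm_num))
  have h : ∀ θ : ℝ, 0 < θ → θ < 2 * Real.pi → θ ≠ Real.pi → 2 ^ (-s) < circleKernel s θ := by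
    intro θ h0 h1 hne
    refine Real.rpow_lt_rpow_of_neg (two_mul_sin_half_pos h0 h1) ?_ (by linarith)
    have h3 : Real.cos (θ / 2) ≠ 0 := by
      intro h4
      apply hne
      have := Real.injOn_cos (x₁ := θ / 2) ⟨by linarith, by linarith⟩
        (x₂ := Real.pi / 2) ⟨by linarith, by linarith⟩ (by rw [h4, Real.cos_pi_div_two])
      linarith
    have := Real.sin_sq_add_cos_sq (θ / 2)
    have := sq_pos_of_ne_zero h3
    nlinarith
  have h1 := h (Real.pi / 2) (by linarith) (by linarith) (by linarith)
  have h2 := h (Real.pi * 3 / 2) (by linarith) (by linarith) (by linarith)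
  rw [midpointSum, Finset.sum_range_succ, Finset.sum_range_one]
  norm_num at h1 h2 ⊢
  linarith

theorem circleMean_two_sub {α : ℝ} (hα : 1 < α) :
    (2 : ℝ) ^ (α - 2) / √Real.pi * (Real.Gamma ((α - 1) / 2) / Real.Gamma (α / 2)) =
      circleMean (2 - α) := by
  rw [circleMean_eq (by linarith)]
  congr 3 <;> ring_nf

theorem tendsto_pointMassConstant_div_of_one_lt {α : ℝ} (hα : 1 < α) (hα2 : α < 2) :
    Tendsto (fun m : ℕ => pointMassConstant α m planeCircle /
          ((2 : ℝ) ^ (α - 2) - (2 : ℝ) ^ (α - 2) / √Real.pi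
            * (Real.Gamma ((α - 1) / 2) / Real.Gamma (α / 2))))
        atTop (𝓝 1) := by
  rw [circleMean_two_sub hα]
  have h := two_rpow_neg_lt_circleMean (s := 2 - α) (by linarith) (by linarith)
  rw [neg_sub] at h
  have hne : (2 : ℝ) ^ (α - 2) - circleMean (2 - α) ≠ 0 := by linarith
  have hlim := ((tendsto_midpointSum_div (s := 2 - α) (by linarith) (by linarith)).const_sub
    ((2 : ℝ) ^ (α - 2))).div_const ((2 : ℝ) ^ (α - 2) - circleMean (2 - α))
  rw [div_self hne] at hlim
  refine hlim.congr' ?_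
  filter_upwards [eventually_gt_atTop 0] with m hm
  rw [pointMassConstant_eq hα2 hm]

/-! ### Discrete energies and the lower bound for the energy of a measure. -/

theorem sum_gap_eq {m : ℕ} (hm : 0 < m) {x : ℕ → ℝ} (hper : ∀ k, x (k + m) = x k + 2 * Real.pi)
    (k : ℕ) : ∑ i ∈ Finset.range m, (x (k + i) - x i) = 2 * Real.pi * k := by
  have hm' : (0 : ℝ) < m := by exact_mod_cast hm
  have hD : ∀ i : ℕ, x (i + m) - 2 * Real.pi * (i + m : ℕ) / m = x i - 2 * Real.pi * i / m := by
    intro i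
    rw [hper]
    push_cast
    field_simp
    ring
  have h := sum_range_add_of_periodic (F := fun i : ℕ => x i - 2 * Real.pi * i / m) hD k
  have h2 : ∀ i : ℕ, x (k + i) - x i = ((x (k + i) - 2 * Real.pi * (k + i : ℕ) / m) -
      (x i - 2 * Real.pi * i / m)) + 2 * Real.pi * k / m := by
    intro i
    push_cast
    ring
  rw [Finset.sum_congr rfl fun i _ => h2 i, Finset.sum_add_distrib, Finset.sum_sub_distrib, h,
    sub_self, zero_add, Finset.sum_const, Finset.card_range, nsmul_eq_mul]
  field_simp

/-- Among sorted points of the circle, the energy of the pairs at index distance `k` is at least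
that of equally spaced points. -/
theorem le_sum_rieszKernel_shift {s : ℝ} (hs : 0 < s) {m : ℕ} {x : ℕ → ℝ} (hx : Monotone x)
    (hper : ∀ k, x (k + m) = x k + 2 * Real.pi) {k : ℕ} (hk : 0 < k) (hkm : k < m) :
    ENNReal.ofReal (m * circleKernel s (2 * Real.pi / m * k)) ≤
      ∑ i ∈ Finset.range m, rieszKernel s (Complex.exp (x i * Complex.I))
        (Complex.exp (x (k + i) * Complex.I)) := by
  have hm : 0 < m := by omega
  have hm' : (0 : ℝ) < m := by exact_mod_cast hm
  have hk' : (0 : ℝ) < k := by exact_mod_cast hk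
  have hkm' : (k : ℝ) < m := by exact_mod_cast hkm
  have hπ := Real.pi_pos
  -- A coincidence of two points makes the right side infinite; otherwise all gaps lie in (0, 2π).
  by_cases hdeg : ∃ i < m, x (k + i) = x i ∨ x (k + i) = x i + 2 * Real.pi
  · obtain ⟨i, hi, h⟩ := hdeg
    refine le_trans le_top (le_of_eq (Eq.symm (ENNReal.sum_eq_top.2 ⟨i, Finset.mem_range.2 hi, ?_⟩)))
    have : Complex.exp (x (k + i) * Complex.I) = Complex.exp (x i * Complex.I) := by
      rcases h with h | h
      · rw [h]
      · rw [h, ← exp_add_two_pi_mul_I (x i) 1, Nat.cast_one, mul_one]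
    rw [this, rieszKernel_self hs]
  push Not at hdeg
  have hmem : ∀ i ∈ Finset.range m, x (k + i) - x i ∈ Set.Ioo 0 (2 * Real.pi) := by
    intro i hi
    obtain ⟨h1, h2⟩ := hdeg i (Finset.mem_range.1 hi)
    have h3 : x i ≤ x (k + i) := hx (by omega)
    have h4 : x (k + i) ≤ x (i + m) := hx (by omega)
    rw [hper] at h4
    exact ⟨sub_pos.2 (lt_of_le_of_ne h3 h1.symm), by linarith [lt_of_le_of_ne h4 h2]⟩
  rw [Finset.sum_congr rfl fun i hi => rieszKernel_exp s (by linarith [(hmem i hi).1])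
      (by linarith [(hmem i hi).2]),
    ← ENNReal.ofReal_sum_of_nonneg fun i hi => (circleKernel_pos s (hmem i hi).1 (hmem i hi).2).le]
  refine ENNReal.ofReal_le_ofReal ?_
  have ht : 2 * Real.pi / m * k ∈ Set.Ioo 0 (2 * Real.pi) := by
    refine ⟨by positivity, ?_⟩
    rw [div_mul_eq_mul_div, div_lt_iff₀ hm']
    nlinarith
  -- The tangent is taken at the mean gap 2πk/m. The gaps sum to 2πk, so the slope terms cancel.
  have h := Finset.sum_le_sum fun i hi => (convexOn_circleKernel hs).tangent_le ht (hmem i hi)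
    (differentiableAt_circleKernel s ht.1 ht.2)
  rw [Finset.sum_add_distrib, ← Finset.mul_sum, Finset.sum_sub_distrib _ (fun _ => _),
    sum_gap_eq hm hper] at h
  simp only [Finset.sum_const, Finset.card_range, nsmul_eq_mul] at h
  have h0 : 2 * Real.pi * k - m * (2 * Real.pi / m * k) = 0 := by field_simp; ring
  rw [h0, mul_zero, add_zero] at h
  exact h

/-- Equally spaced points minimize the discrete Riesz energy on the circle. -/
theorem le_sum_rieszKernel_offDiag {s : ℝ} (hs : 0 < s) {n : ℕ} {a : Fin (n + 1) → ℂ}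
    (ha : ∀ j, a j ∈ planeCircle) :
    ENNReal.ofReal ((n + 1 : ℕ) * ∑ k ∈ Finset.range n,
        circleKernel s (2 * Real.pi / (n + 1 : ℕ) * (k + 1 : ℕ))) ≤
      ∑ i, ∑ j, if i = j then 0 else rieszKernel s (a i) (a j) := by
  obtain ⟨x, hx, hper, σ, hσ⟩ := exists_monotone_lift n.succ_pos ha
  set e : ℕ → ℂ := fun k => Complex.exp (x k * Complex.I) with he
  have heper : ∀ k, e (k + (n + 1)) = e k := fun k => by
    have := exp_add_two_pi_mul_I (x k) 1
    simp only [Nat.cast_one, mul_one] at this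
    simp only [he, hper, this]
  have h1 : ∑ i, ∑ j, (if i = j then 0 else rieszKernel s (a i) (a j)) =
      ∑ i ∈ Finset.range (n + 1), ∑ k ∈ Finset.range (n + 1),
        if k % (n + 1) = i then 0 else rieszKernel s (e i) (e k) := by
    rw [← Fin.sum_univ_eq_sum_range (fun i => ∑ k ∈ Finset.range (n + 1),
        if k % (n + 1) = i then 0 else rieszKernel s (e i) (e k)), ← Equiv.sum_comp σ]
    refine Finset.sum_congr rfl fun i _ => ?_
    rw [← Fin.sum_univ_eq_sum_range (fun k =>
        if k % (n + 1) = (i : ℕ) then 0 else rieszKernel s (e i) (e k)), ← Equiv.sum_comp σ]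
    refine Finset.sum_congr rfl fun j _ => ?_
    simp only [Nat.mod_eq_of_lt j.2, he, hσ, EmbeddingLike.apply_eq_iff_eq, Fin.ext_iff,
      eq_comm (a := (i : ℕ))]
  have h2 : ∀ i ∈ Finset.range (n + 1), ∑ k ∈ Finset.range (n + 1),
      (if k % (n + 1) = i then 0 else rieszKernel s (e i) (e k)) =
      ∑ k ∈ Finset.range n, rieszKernel s (e i) (e (k + 1 + i)) := by
    intro i hi
    have hi := Finset.mem_range.1 hi
    -- Starting the inner sum at the index i puts the omitted diagonal term first.
    rw [← sum_range_add_of_periodic (fun k => by rw [Nat.add_mod_right, heper]) i,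
      Finset.sum_range_succ', add_zero, Nat.mod_eq_of_lt hi, if_pos rfl, add_zero]
    refine Finset.sum_congr rfl fun k hk => ?_
    have hk := Finset.mem_range.1 hk
    rw [if_neg, add_comm]
    intro h
    have h3 : i + (k + 1) ≡ i + 0 [MOD (n + 1)] := by
      rw [Nat.ModEq, h, add_zero, Nat.mod_eq_of_lt hi]
    have h4 := Nat.ModEq.add_left_cancel' i h3
    rw [Nat.ModEq, Nat.zero_mod, Nat.mod_eq_of_lt (by omega)] at h4
    omega
  rw [h1, Finset.sum_congr rfl h2, Finset.sum_comm, Finset.mul_sum, ENNReal.ofReal_sum_of_nonneg]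
  · exact Finset.sum_le_sum fun k hk =>
      le_sum_rieszKernel_shift hs hx hper k.succ_pos (by have := Finset.mem_range.1 hk; omega)
  · intro k hk
    have hk : ((k + 1 : ℕ) : ℝ) < (n + 1 : ℕ) := by
      exact_mod_cast (by have := Finset.mem_range.1 hk; omega)
    have hπ := Real.pi_pos
    refine mul_nonneg (by positivity) (circleKernel_pos s (by positivity) ?_).le
    rw [div_mul_eq_mul_div, div_lt_iff₀ (by positivity)]
    nlinarith

theorem map_eval_prod_pi {ι X : Type*} [Fintype ι] [MeasurableSpace X] (μ : Measure X)
    [IsProbabilityMeasure μ] {i j : ι} (hij : i ≠ j) :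
    (Measure.pi fun _ : ι => μ).map (fun a => (a i, a j)) = μ.prod μ := by
  have h := (ProbabilityTheory.iIndepFun_pi (μ := fun _ : ι => μ) (X := fun _ x => x)
    fun _ => aemeasurable_id').indepFun hij
  rw [ProbabilityTheory.indepFun_iff_map_prod_eq_prod_map_map
    (measurable_pi_apply i).aemeasurable (measurable_pi_apply j).aemeasurable] at h
  rw [h, (measurePreserving_eval (fun _ : ι => μ) i).map_eq,
    (measurePreserving_eval (fun _ : ι => μ) j).map_eq]

/-- The energy of a probability measure on the circle is bounded below by averaging the energy of
random samples. -/
theorem le_rieszEnergy_of_sample {α : ℝ} (hα : α < 2) (μ : Measure ℂ) [IsProbabilityMeasure μ]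
    (hμ : μ planeCircleᶜ = 0) (n : ℕ) :
    ENNReal.ofReal ((∑ k ∈ Finset.range n,
        circleKernel (2 - α) (2 * Real.pi / (n + 1 : ℕ) * (k + 1 : ℕ))) / (n + 1 : ℕ)) ≤
      rieszEnergy α μ := by
  have hs : 0 < 2 - α := by linarith
  set P := Measure.pi fun _ : Fin (n + 1) => μ
  have hE : rieszEnergy α μ = ∫⁻ p, rieszKernel (2 - α) p.1 p.2 ∂(μ.prod μ) := by
    rw [lintegral_prod _ (measurable_rieszKernel _).aemeasurable]
    rfl
  have hae : ∀ᵐ a ∂P, ∀ j, a j ∈ planeCircle := by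
    rw [ae_all_iff]
    intro j
    exact (measurePreserving_eval (fun _ : Fin (n + 1) => μ) j).quasiMeasurePreserving.ae
      (mem_ae_iff.2 hμ)
  have hint := lintegral_mono_ae (hae.mono fun a ha => le_sum_rieszKernel_offDiag hs ha)
  rw [lintegral_const, measure_univ, mul_one] at hint
  have hmeas : ∀ i j : Fin (n + 1), Measurable fun a : Fin (n + 1) → ℂ =>
      if i = j then 0 else rieszKernel (2 - α) (a i) (a j) := by
    intro i j
    split_ifs
    · exact measurable_const
    · exact (measurable_rieszKernel _).comp (f := fun a : Fin (n + 1) → ℂ => (a i, a j)) (by fun_prop)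
  rw [lintegral_finsetSum _ fun i _ => Finset.measurable_sum _ fun j _ => hmeas i j] at hint
  have hterm : ∀ i j : Fin (n + 1),
      ∫⁻ a, (if i = j then 0 else rieszKernel (2 - α) (a i) (a j)) ∂P ≤ rieszEnergy α μ := by
    intro i j
    split_ifs with h
    · simp
    · rw [hE, ← map_eval_prod_pi μ h, lintegral_map (measurable_rieszKernel _) (by fun_prop)]
  -- All (n+1)² pairs are counted, although the diagonal ones contribute zero; the loss disappears
  -- as n → ∞.
  have hle : ENNReal.ofReal ((n + 1 : ℕ) * ∑ k ∈ Finset.range n,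
      circleKernel (2 - α) (2 * Real.pi / (n + 1 : ℕ) * (k + 1 : ℕ))) ≤
      ((n + 1 : ℕ) : ℝ≥0∞) * (((n + 1 : ℕ) : ℝ≥0∞) * rieszEnergy α μ) := by
    refine hint.trans ((Finset.sum_le_sum
      (g := fun _ => ((n + 1 : ℕ) : ℝ≥0∞) * rieszEnergy α μ) fun i _ => ?_).trans (le_of_eq ?_))
    · rw [lintegral_finsetSum _ fun j _ => hmeas i j]
      refine (Finset.sum_le_sum fun j _ => hterm i j).trans (le_of_eq ?_)
      simp
    · simp
  have hN : (0 : ℝ) < (n + 1 : ℕ) := by positivity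
  rw [ENNReal.ofReal_mul hN.le, ENNReal.ofReal_natCast,
    ENNReal.mul_le_mul_iff_right (by simp) (by simp)] at hle
  rw [ENNReal.ofReal_div_of_pos hN, ENNReal.ofReal_natCast]
  exact ENNReal.div_le_of_le_mul' hle

theorem integral_le_sum_equally_spaced {s : ℝ} (hs : 0 < s) {m : ℕ} (hm : 2 ≤ m) :
    (∫ θ in 2 * Real.pi / m * 1..2 * Real.pi / m * (1 + (m / 2 - 1 : ℕ)), circleKernel s θ) /
      Real.pi ≤ (∑ k ∈ Finset.range (m - 1), circleKernel s (2 * Real.pi / m * (k + 1 : ℕ))) / m := by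
  have hπ := Real.pi_pos
  have hm' : (0 : ℝ) < m := by exact_mod_cast (by omega : 0 < m)
  have h1 := integral_le_sum_circleKernel hs (h := 2 * Real.pi / m) (by positivity)
    one_pos (mesh_mul_le_pi hm le_rfl)
  set n := m / 2 - 1 with hn
  set g : ℕ → ℝ := fun k => circleKernel s (2 * Real.pi / m * (k + 1 : ℕ)) with hg
  have hg0 : ∀ k, k < m - 1 → 0 ≤ g k := by
    intro k hk
    have hk : ((k + 1 : ℕ) : ℝ) < m := by exact_mod_cast (by omega)
    refine (circleKernel_pos s (by positivity) ?_).le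
    rw [div_mul_eq_mul_div, div_lt_iff₀ hm']
    nlinarith
  -- The first and last n terms are mirror images, and the few middle terms are nonnegative and
  -- discarded, so the antitone estimate is needed on one half only.
  have hsplit : ∑ k ∈ Finset.range (m - 1), g k = ∑ k ∈ Finset.range n, g k +
      ∑ k ∈ Finset.range (m - 1 - n - n), g (n + k) +
      ∑ k ∈ Finset.range n, g (n + (m - 1 - n - n) + k) := by
    rw [← Finset.sum_range_add, ← Finset.sum_range_add]
    congr 2
    omega
  have hmid : 0 ≤ ∑ k ∈ Finset.range (m - 1 - n - n), g (n + k) :=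
    Finset.sum_nonneg fun k hk => hg0 _ (by have := Finset.mem_range.1 hk; omega)
  have hlast : ∑ k ∈ Finset.range n, g (n + (m - 1 - n - n) + k) = ∑ k ∈ Finset.range n, g k := by
    rw [← Finset.sum_range_reflect]
    refine Finset.sum_congr rfl fun k hk => ?_
    have hk := Finset.mem_range.1 hk
    simp only [hg]
    rw [← circleKernel_symm]
    congr 1
    rw [show n + (m - 1 - n - n) + (n - 1 - k) + 1 = m - (k + 1) by omega,
      Nat.cast_sub (by omega)]
    field_simp
    ring
  have hfirst : ∑ i ∈ Finset.range n, circleKernel s (2 * Real.pi / m * (1 + i)) =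
      ∑ k ∈ Finset.range n, g k :=
    Finset.sum_congr rfl fun i _ => by simp only [hg]; push_cast; rw [add_comm]
  rw [hfirst, div_mul_eq_mul_div (2 * Real.pi) (m : ℝ) (Finset.sum _ _), le_div_iff₀ hm'] at h1
  rw [div_le_div_iff₀ hπ hm', hsplit, hlast]
  nlinarith

/-- The sampling bound holds for every sample size, and its lower estimate by integrals tends to the
mean. -/
theorem circleMean_le_rieszEnergy {α : ℝ} (hα : 1 < α) (hα2 : α < 2) (μ : Measure ℂ)
    [IsProbabilityMeasure μ] (hμ : μ planeCircleᶜ = 0) :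
    ENNReal.ofReal (circleMean (2 - α)) ≤ rieszEnergy α μ := by
  have h := tendsto_integral_circleKernel (s := 2 - α) (by linarith) 1 zero_le_one le_rfl
  refine le_of_tendsto (ENNReal.tendsto_ofReal h) ?_
  filter_upwards [eventually_ge_atTop 2] with m hm
  refine le_trans (ENNReal.ofReal_le_ofReal
    (integral_le_sum_equally_spaced (by linarith) hm)) ?_
  have := le_rieszEnergy_of_sample hα2 μ hμ (m - 1)
  rwa [Nat.sub_add_cancel (by omega)] at this

/-! ### Arc length as an equilibrium measure, and the Wiener constant. -/

/-- The normalized arc length measure on the unit circle. -/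
noncomputable def circleMeasure : Measure ℂ :=
  ((ENNReal.ofReal (2 * Real.pi))⁻¹ • volume.restrict (Set.Ioc 0 (2 * Real.pi))).map
    fun θ : ℝ => Complex.exp (θ * Complex.I)

theorem measurable_exp_mul_I : Measurable fun θ : ℝ => Complex.exp (θ * Complex.I) := by fun_prop

theorem ofReal_two_pi_ne_zero : ENNReal.ofReal (2 * Real.pi) ≠ 0 := by
  have := Real.pi_pos
  simp [this]

instance : IsProbabilityMeasure circleMeasure := by
  refine ⟨?_⟩
  rw [circleMeasure, Measure.map_apply measurable_exp_mul_I MeasurableSet.univ]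
  simp only [Set.preimage_univ, Measure.smul_apply, Measure.restrict_apply_univ, Real.volume_Ioc,
    sub_zero, smul_eq_mul]
  exact ENNReal.inv_mul_cancel ofReal_two_pi_ne_zero ENNReal.ofReal_ne_top

theorem circleMeasure_compl : circleMeasure planeCircleᶜ = 0 := by
  have hm : MeasurableSet planeCircle := Metric.isClosed_sphere.measurableSet
  rw [circleMeasure, Measure.map_apply measurable_exp_mul_I hm.compl]
  have : (fun θ : ℝ => Complex.exp (θ * Complex.I)) ⁻¹' planeCircleᶜ = ∅ := by
    ext θ
    simp [exp_mem_planeCircle]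
  rw [this, measure_empty]

theorem lintegral_circleKernel {s : ℝ} (hs1 : s < 1) :
    ∫⁻ θ in Set.Ioc 0 (2 * Real.pi), ENNReal.ofReal (circleKernel s θ) =
      ENNReal.ofReal (2 * Real.pi * circleMean s) := by
  have hπ := Real.pi_pos
  rw [circleMean, mul_div_cancel₀ _ (by positivity),
    intervalIntegral.integral_of_le (by positivity), ← restrict_Ioo_eq_restrict_Ioc,
    ofReal_integral_eq_lintegral_ofReal (integrableOn_circleKernel hs1)]
  exact (ae_restrict_mem measurableSet_Ioo).mono fun θ hθ => (circleKernel_pos s hθ.1 hθ.2).le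

theorem lintegral_rieszKernel_exp {s : ℝ} (hs1 : s < 1) (φ : ℝ) :
    ∫⁻ θ in Set.Ioc 0 (2 * Real.pi), rieszKernel s (Complex.exp (φ * Complex.I))
      (Complex.exp ((θ : ℝ) * Complex.I)) = ENNReal.ofReal (2 * Real.pi * circleMean s) := by
  have hπ := Real.pi_pos
  have h2π : 0 < 2 * Real.pi := by positivity
  set f : ℝ → ℝ≥0∞ := fun θ => rieszKernel s (Complex.exp (φ * Complex.I))
      (Complex.exp ((θ : ℝ) * Complex.I)) with hf
  have hper : Function.Periodic f (2 * Real.pi) := fun θ => by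
    have := exp_add_two_pi_mul_I θ 1
    simp only [Nat.cast_one, mul_one] at this
    simp only [hf, this]
  have : VAddInvariantMeasure (AddSubgroup.zmultiples (2 * Real.pi)) ℝ volume :=
    ⟨fun c s _ => measure_preimage_add _ _ _⟩
  -- The integral over a period does not depend on its starting point; starting at φ puts the
  -- singularities at the endpoints.
  have h := (isAddFundamentalDomain_Ioc h2π 0).setLIntegral_eq (isAddFundamentalDomain_Ioc h2π φ) f
    hper.map_vadd_zmultiples
  rw [zero_add] at h
  rw [h, ← lintegral_circleKernel hs1, ← restrict_Ioo_eq_restrict_Ioc, ← restrict_Ioo_eq_restrict_Ioc,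
    setLIntegral_congr_fun (g := fun θ => ENNReal.ofReal (circleKernel s (θ - φ)))
      measurableSet_Ioo fun θ hθ => rieszKernel_exp s hθ.1 hθ.2,
    ← (measurePreserving_sub_right volume φ).setLIntegral_comp_preimage measurableSet_Ioo
      (measurable_circleKernel s).ennreal_ofReal]
  congr 2
  ext θ
  simp only [Set.mem_Ioo, Set.mem_preimage]
  constructor <;> rintro ⟨h1, h2⟩ <;> constructor <;> linarith

theorem rieszPotential_circleMeasure {α : ℝ} (hα : 1 < α) {z : ℂ} (hz : z ∈ planeCircle) :
    rieszPotential α circleMeasure z = ENNReal.ofReal (circleMean (2 - α)) := by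
  have hπ := Real.pi_pos
  have hmeas : Measurable fun t => rieszKernel (2 - α) z t :=
    (measurable_rieszKernel (2 - α)).comp (f := fun t => (z, t)) (by fun_prop)
  rw [rieszPotential, circleMeasure, lintegral_map hmeas measurable_exp_mul_I,
    lintegral_smul_measure, ← exp_arg_mul_I hz, lintegral_rieszKernel_exp (by linarith),
    ENNReal.ofReal_mul (q := circleMean (2 - α)) (by positivity), smul_eq_mul, ← mul_assoc,
    ENNReal.inv_mul_cancel ofReal_two_pi_ne_zero ENNReal.ofReal_ne_top, one_mul]

theorem rieszEnergy_circleMeasure {α : ℝ} (hα : 1 < α) :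
    rieszEnergy α circleMeasure = ENNReal.ofReal (circleMean (2 - α)) := by
  have hae : ∀ᵐ z ∂circleMeasure, z ∈ planeCircle := mem_ae_iff.2 circleMeasure_compl
  rw [rieszEnergy, lintegral_congr_ae (hae.mono fun z hz => rieszPotential_circleMeasure hα hz),
    lintegral_const, measure_univ, mul_one]

theorem wienerConstant_planeCircle {α : ℝ} (hα : 1 < α) (hα2 : α < 2) :
    wienerConstant α planeCircle = ENNReal.ofReal (circleMean (2 - α)) := by
  refine le_antisymm ?_ (le_iInf fun μ => le_iInf fun hp => le_iInf fun hμ =>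
    circleMean_le_rieszEnergy hα hα2 μ hμ)
  rw [← rieszEnergy_circleMeasure hα]
  exact iInf_le_of_le circleMeasure (iInf₂_le_of_le inferInstance circleMeasure_compl le_rfl)

theorem isRieszEquilibriumMeasure_circleMeasure {α : ℝ} (hα : 1 < α) (hα2 : α < 2) :
    IsRieszEquilibriumMeasure α planeCircle circleMeasure where
  isProbabilityMeasure := inferInstance
  carried := circleMeasure_compl
  energy_eq := by rw [rieszEnergy_circleMeasure hα, wienerConstant_planeCircle hα hα2]
  energy_ne_top := by rw [rieszEnergy_circleMeasure hα]; exact ENNReal.ofReal_ne_top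

theorem isRieszEquilibriumMeasure_rieszEquilibriumMeasure {α : ℝ} (hα : 1 < α) (hα2 : α < 2) :
    IsRieszEquilibriumMeasure α planeCircle (rieszEquilibriumMeasure α planeCircle) := by
  have h : ∃ μ, IsRieszEquilibriumMeasure α planeCircle μ :=
    ⟨_, isRieszEquilibriumMeasure_circleMeasure hα hα2⟩
  rw [rieszEquilibriumMeasure, dif_pos h]
  exact h.choose_spec

/-! ### The reverse triangle constant and the proposition. -/

theorem farthestDist_planeCircle {z : ℂ} (hz : z ∈ planeCircle) : farthestDist planeCircle z = 2 := by
  have hz' : ‖z‖ = 1 := by simpa [planeCircle] using hz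
  have hle : ∀ t : planeCircle, ‖z - t‖ ≤ 2 := fun t => by
    have ht : ‖(t : ℂ)‖ = 1 := by simpa [planeCircle] using t.2
    exact (norm_sub_le _ _).trans (by rw [hz', ht]; norm_num)
  have hneg : -z ∈ planeCircle := by simpa [planeCircle] using hz'
  have : Nonempty planeCircle := ⟨⟨z, hz⟩⟩
  refine le_antisymm (ciSup_le hle) ?_
  refine le_trans (le_of_eq ?_) (le_ciSup ⟨2, Set.forall_mem_range.2 hle⟩ ⟨-z, hneg⟩)
  simp only [sub_neg_eq_add]
  rw [← two_mul, norm_mul, hz']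
  simp

/-- Uniqueness of the equilibrium measure is not needed: the farthest distance is 2 everywhere on
the circle, so any probability measure carried by it gives the same integral. -/
theorem reverseTriangleConstant_planeCircle {α : ℝ} (hα : 1 < α) (hα2 : α < 2) :
    reverseTriangleConstant α planeCircle = 2 ^ (α - 2) - circleMean (2 - α) := by
  have h := isRieszEquilibriumMeasure_rieszEquilibriumMeasure hα hα2
  have hp := h.isProbabilityMeasure
  have hae : ∀ᵐ z ∂rieszEquilibriumMeasure α planeCircle, z ∈ planeCircle := mem_ae_iff.2 h.carried
  have hpos : 0 ≤ circleMean (2 - α) :=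
    (Real.rpow_pos_of_pos two_pos _).le.trans
      (two_rpow_neg_lt_circleMean (s := 2 - α) (by linarith) (by linarith)).le
  rw [reverseTriangleConstant, wienerConstant_planeCircle hα hα2, ENNReal.toReal_ofReal hpos,
    integral_congr_ae (g := fun _ => (2 : ℝ) ^ (α - 2))
      (hae.mono fun z hz => by simp only [farthestDist_planeCircle hz])]
  simp

theorem proposition3p2 (α : ℝ) (hα : α < 2) :
    (∀ m : ℕ, 1 ≤ m →
      IsGreatest (pointMassConstants α m planeCircle) (pointMassConstant α m planeCircle) ∧
      rieszMaxPolarization (2 - α) m planeCircle ≠ ∞ ∧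
      pointMassConstant α m planeCircle =
        (2 : ℝ) ^ (α - 2)
          - (rieszPolarization (2 - α) (unityRoots m) planeCircle).toReal / (m : ℝ) ∧
      pointMassConstant α m planeCircle =
        (2 : ℝ) ^ (α - 2) - (rieszMaxPolarization (2 - α) m planeCircle).toReal / (m : ℝ)) ∧
    (α < 1 →
      Tendsto (fun m : ℕ => pointMassConstant α m planeCircle /
          (-(2 * (riemannZeta ((2 - α : ℝ) : ℂ)).re / (2 * Real.pi) ^ (2 - α)
            * ((2 : ℝ) ^ (2 - α) - 1) * (m : ℝ) ^ (1 - α))))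
        atTop (𝓝 1)) ∧
    (α = 1 →
      Tendsto (fun m : ℕ => pointMassConstant α m planeCircle /
          (-(1 / Real.pi * Real.log (m : ℝ))))
        atTop (𝓝 1)) ∧
    (1 < α →
      Tendsto (fun m : ℕ => pointMassConstant α m planeCircle /
          ((2 : ℝ) ^ (α - 2) - (2 : ℝ) ^ (α - 2) / √Real.pi
            * (Real.Gamma ((α - 1) / 2) / Real.Gamma (α / 2))))
        atTop (𝓝 1) ∧
      (2 : ℝ) ^ (α - 2) - (2 : ℝ) ^ (α - 2) / √Real.pi
            * (Real.Gamma ((α - 1) / 2) / Real.Gamma (α / 2))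
        = reverseTriangleConstant α planeCircle) := by
  refine ⟨fun m hm => ?_, tendsto_pointMassConstant_div_of_lt_one, ?_, fun h =>
    ⟨tendsto_pointMassConstant_div_of_one_lt h hα, ?_⟩⟩
  · have hs : 0 < 2 - α := by linarith
    have hV := midpointSum_nonneg (2 - α) m
    rw [rieszPolarization_unityRoots hs hm, rieszMaxPolarization_planeCircle hs hm,
      ENNReal.toReal_ofReal hV, pointMassConstant_eq hα hm]
    exact ⟨isGreatest_pointMassConstants hα hm, ENNReal.ofReal_ne_top, rfl, rfl⟩
  · rintro rfl
    exact tendsto_pointMassConstant_one_div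
  · rw [circleMean_two_sub h, reverseTriangleConstant_planeCircle h hα]
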